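/- Let $p$ be a prime, put $q=p$ if $p>2$ and $q=4$ if $p=2$, and let $\gamma$ be a topological generator of $1+q\mathbb{Z}_p$. Let $\widehat{\mathbb{G}}_m$ be the formal multiplicative group over $\mathbb{Z}_p$, with group law $x\oplus y=x+y+xy$, applied coordinatewise on $\widehat{\mathbb{G}}_m^2$. Let $L_p(w,T)\in\mathbb{Z}_p[[w,T]]$ be a power series and let $$\Sigma\subset\{(\gamma^k\zeta-1,\gamma^s\zeta'-1)\ :\ k\in\mathbb{N},\ s\in\mathbb{Z},\ 0\le s\le k-1,\ \zeta,\zeta'\in\mu_{p^\infty}\}$$ be any subset, where $\mu_{p^\infty}$ denotes the group of $p$-power roots of unity in $\overline{\mathbb{Q}}_p\subset\mathbb{C}_p$. Suppose that there is a non-trivial formal character $\chi$ of $\widehat{\mathbb{G}}_m^2$ (a homomorphism of formal groups $\widehat{\mathbb{G}}_m^2\to\widehat{\mathbb{G}}_m$ over $\mathbb{Z}_p$) such that the set of values $\chi(\gamma^k-1,\gamma^s-1)$, for $(k,s)$ running through the exponents that occur in $\Sigma$, is finite. Then at least one of the following holds: 1. There are only finitely many $(w,T)\in\Sigma$ with $L_p(w,T)=0$.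 2. There are a point $P\in\Sigma$ and a formal subtorus $H$ of $\widehat{\mathbb{G}}_m^2$ of positive dimension over $\mathbb{Z}_p$ (the image of a homomorphism of formal groups $\widehat{\mathbb{G}}_m^d\to\widehat{\mathbb{G}}_m^2$, $d\ge 1$, that is a closed immersion) such that $L_p$ vanishes along the translate $P\oplus H$, that is, $L_p(P\oplus Q)=0$ for all points $Q$ of $H$ with coordinates in the maximal ideal of the ring of integers of $\mathbb{C}_p$. If moreover $\Sigma$ is stable under translation by the torsion points $(\eta-1,\eta'-1)$, $\eta,\eta'\in\mu_{p^\infty}$, of $\widehat{\mathbb{G}}_m^2$, then exactly one of 1. and 2. holds. -/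

import Mathlib

noncomputable section

/-! ### Homomorphisms between formal tori -/

/-- The group law of the formal torus `𝔾ₘ^m` over `R`: the `i`-th coordinate is
`Xᵢ + Yᵢ + Xᵢ Yᵢ`, where `Xᵢ = X (inl i)` and `Yᵢ = X (inr i)`. -/
def formalTorusLaw (R : Type*) [CommRing R] (m : ℕ) :
    Fin m → MvPowerSeries (Fin m ⊕ Fin m) R := fun i =>
  (FormalGroup.𝔾ₘ : FormalGroup R).toPowerSeries.subst
    ![(MvPowerSeries.X (Sum.inl i) : MvPowerSeries (Fin m ⊕ Fin m) R),
      MvPowerSeries.X (Sum.inr i)]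

/-- A homomorphism of formal groups `𝔾ₘ^m → 𝔾ₘ^n` over `R`: an `n`-tuple `f` of power series in `m`
variables without constant term such that `f (X ⊕ Y) = f X ⊕ f Y` for the multiplicative formal
group laws on both sides. -/
structure FormalTorusHom (R : Type*) [CommRing R] (m n : ℕ) where
  /-- The coordinates of the homomorphism. -/
  toSeries : Fin n → MvPowerSeries (Fin m) R
  constantCoeff_eq_zero : ∀ i, MvPowerSeries.constantCoeff (toSeries i) = 0
  map_law : ∀ i,
    MvPowerSeries.subst (formalTorusLaw R m) (toSeries i) =
      (FormalGroup.𝔾ₘ : FormalGroup R).toPowerSeries.subst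
        ![MvPowerSeries.subst
            (fun j => (MvPowerSeries.X (Sum.inl j) : MvPowerSeries (Fin m ⊕ Fin m) R))
            (toSeries i),
          MvPowerSeries.subst
            (fun j => (MvPowerSeries.X (Sum.inr j) : MvPowerSeries (Fin m ⊕ Fin m) R))
            (toSeries i)]

/-- A formal character of `𝔾ₘ^n`: a homomorphism of formal groups `𝔾ₘ^n → 𝔾ₘ`. -/
abbrev FormalCharacter (R : Type*) [CommRing R] (n : ℕ) := FormalTorusHom R n 1

/-- A `d`-dimensional formal subtorus of `𝔾ₘ^n` over `R`, given by an embedding: a homomorphism of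
formal groups `𝔾ₘ^d → 𝔾ₘ^n` that is a closed immersion, that is, the induced map
`R⟦X₁, …, Xₙ⟧ → R⟦X₁, …, X_d⟧` on coordinate rings is surjective. -/
structure FormalSubtorus (R : Type*) [CommRing R] (n d : ℕ) extends FormalTorusHom R d n where
  surjective : Function.Surjective
    (fun g : MvPowerSeries (Fin n) R => (MvPowerSeries.subst toSeries g : MvPowerSeries (Fin d) R))

/-! ### Points with coordinates in the maximal ideal of the `p`-adic complex numbers -/

variable (p : ℕ) [Fact p.Prime]

/-- The inclusion of the `p`-adic integers into `ℂ_[p]`. -/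
def padicIntToComplex (a : ℤ_[p]) : ℂ_[p] := algebraMap ℚ_[p] ℂ_[p] (a : ℚ_[p])

/-- The value of a power series with `p`-adic integer coefficients at a point `z`. It is only used
for `‖z i‖ < 1`, where the series converges. -/
def padicEval {n : ℕ} (f : MvPowerSeries (Fin n) ℤ_[p]) (z : Fin n → ℂ_[p]) : ℂ_[p] :=
  ∑' e : Fin n →₀ ℕ, padicIntToComplex p (MvPowerSeries.coeff e f) * ∏ i, z i ^ e i

/-- `L` vanishes along the translate `P ⊕ H` of the formal subtorus `H` by the point `P`, where `⊕`
is the law `x ⊕ y = x + y + x y` in each coordinate: `L (P ⊕ Q) = 0` for all points `Q` of `H` over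
the maximal ideal of `ℂ_[p]`. -/
def VanishesAlongTranslate {n d : ℕ} (L : MvPowerSeries (Fin n) ℤ_[p])
    (P : Fin n → ℂ_[p]) (H : FormalSubtorus ℤ_[p] n d) : Prop :=
  ∀ z : Fin d → ℂ_[p], (∀ j, ‖z j‖ < 1) →
    padicEval p L
      (fun i => P i + padicEval p (H.toSeries i) z + P i * padicEval p (H.toSeries i) z) = 0

/-! ### The interpolation points -/

/-- `γ` is a topological generator of `1 + q ℤ_p`, where `q = p` for `p > 2` and `q = 4` for
`p = 2`. -/
def IsTopologicalGenerator (γ : ℤ_[p]ˣ) : Prop :=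
  closure ((Subgroup.zpowers γ : Subgroup ℤ_[p]ˣ) : Set ℤ_[p]ˣ) =
    {u : ℤ_[p]ˣ | ((if p = 2 then 4 else p : ℕ) : ℤ_[p]) ∣ (u : ℤ_[p]) - 1}

/-- `ζ` is a root of unity of `p`-power order. -/
def IsPPowerRootOfUnity (ζ : ℂ_[p]) : Prop := ∃ n : ℕ, ζ ^ p ^ n = 1

/-- The point `(γ ^ k ζ - 1, γ ^ s ζ' - 1)`. -/
def interpolationPoint (γ : ℤ_[p]ˣ) (k s : ℕ) (ζ ζ' : ℂ_[p]) : Fin 2 → ℂ_[p] :=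
  ![padicIntToComplex p γ ^ k * ζ - 1, padicIntToComplex p γ ^ s * ζ' - 1]

/-- All points `(γ ^ k ζ - 1, γ ^ s ζ' - 1)` with `0 ≤ s ≤ k - 1` and `p`-power roots of unity
`ζ`, `ζ'`. -/
def interpolationPoints (γ : ℤ_[p]ˣ) : Set (Fin 2 → ℂ_[p]) :=
  {P | ∃ k s : ℕ, s < k ∧ ∃ ζ ζ' : ℂ_[p], IsPPowerRootOfUnity p ζ ∧ IsPPowerRootOfUnity p ζ' ∧
    P = interpolationPoint p γ k s ζ ζ'}

/-- The exponents `(k, s)` that occur in a set `S` of interpolation points. -/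
def occurringExponents (γ : ℤ_[p]ˣ) (S : Set (Fin 2 → ℂ_[p])) : Set (ℕ × ℕ) :=
  {e | e.2 < e.1 ∧ ∃ ζ ζ' : ℂ_[p], IsPPowerRootOfUnity p ζ ∧ IsPPowerRootOfUnity p ζ' ∧
    interpolationPoint p γ e.1 e.2 ζ ζ' ∈ S}

/-- `S` is stable under translation by the torsion points `(η - 1, η' - 1)` of `𝔾ₘ²`, with
`p`-power roots of unity `η`, `η'`. -/
def IsTorsionStable (S : Set (Fin 2 → ℂ_[p])) : Prop :=
  ∀ P ∈ S, ∀ η η' : ℂ_[p], IsPPowerRootOfUnity p η → IsPPowerRootOfUnity p η' →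
    ![(1 + P 0) * η - 1, (1 + P 1) * η' - 1] ∈ S

end

/-! Suppose that there are infinitely many zeros, written coordinatewise as `γ ^ k i * ζ i - 1`, and
take a non-principal ultrafilter on them. Of two `p`-power roots of unity one is a power of the
other, so along the ultrafilter `ζ i₁ = ζ i₀ ^ c` for a fixed choice of `i₀`, `i₁`. In every case
the subtorus found is a line with one exponent equal to one (`lineSubtorus`), translated by one of
the zeros.

If the order of `ζ i₀` is unbounded (`exists_eval_eq_zero_of_unbounded_order`), let `j` be the limit
of `c` in `ℤ_p` and use the chart `w i₀ = 1 + x`, `w i₁ = (1 + x) ^ j * (1 + y)`. The norm of `x`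
tends to one, since primitive roots of large order are far from `1` and powers of `γ` are too close
to `1` to matter. The torsion part of `1 + y` is `ζ i₀ ^ (c - j)`. If its order is unbounded too,
`‖y‖` tends to one but stays below any given power of `‖x‖`. If it is bounded, `y` can be recentred
so as to tend to zero. The pullback of `L` has coefficients in some `ℤ_p[μ_{p^N}]`, which is
compact, so their norms are discrete away from zero and a nonzero series has a dominant monomial at
such points (`exists_ne_zero_of_norm_near_one`, `exists_ne_zero_of_near_axis`). Hence the pullback
is zero, or `y = 0` at some zero and the pullback vanishes on the whole axis; both give a line.

If the order is bounded, the `ζ i` are constant along the ultrafilter. On exponents the character is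
a nonzero linear form over `ℤ_p` (`exists_linear_form`), and finiteness of its values places the
exponents on one line. By compactness of `ℤ_p` the zeros accumulate there, so a one-variable series
vanishes identically (`eval_eq_zero_of_zeros_on_line`).

For exclusivity, translating the point by the torsion of a subtorus gives infinitely many zeros in a
torsion stable set; a closed immersion is injective on points. -/

/-! ### Evaluation and composition of power series over an ultrametric field. -/

section PowerSeriesEvaluation

set_option linter.unusedSectionVars false

open MvPowerSeries Filter Topology

variable {K : Type*} [NormedField K] [IsUltrametricDist K]

/-- The closed unit ball of a nonarchimedean normed field. -/
def closedUnitBallSubring (K : Type*) [NormedField K] [IsUltrametricDist K] : Subring K where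
  carrier := {x | ‖x‖ ≤ 1}
  mul_mem' {a b} ha hb := by
    simpa using mul_le_one₀ (show ‖a‖ ≤ 1 from ha) (norm_nonneg b) (show ‖b‖ ≤ 1 from hb)
  one_mem' := by simp
  add_mem' {a b} ha hb := (IsUltrametricDist.norm_add_le_max a b).trans (max_le ha hb)
  zero_mem' := by simp
  neg_mem' {a} ha := by simpa using ha

theorem isClosed_closedUnitBallSubring : IsClosed (closedUnitBallSubring K : Set K) :=
  isClosed_le continuous_norm continuous_const

/-- Multiplication by elements of norm at most one does not enlarge norms, so the open balls around
zero are ideals. This makes the topological evaluation `eval₂` available with values in `A`. -/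
theorem isLinearTopology_of_norm_le_one {A : Subring K} (hA : ∀ x ∈ A, ‖x‖ ≤ 1) :
    IsLinearTopology A A := by
  let J : ℝ → Ideal A := fun ε =>
    if h : 0 < ε then
      { carrier := {x | ‖(x : K)‖ < ε}
        add_mem' := fun {a b} ha hb =>
          (IsUltrametricDist.norm_add_le_max (a : K) b).trans_lt (max_lt ha hb)
        zero_mem' := by simpa using h
        smul_mem' := fun c x hx => by
          have hx : ‖(x : K)‖ < ε := hx
          have := mul_le_mul_of_nonneg_right (hA c c.2) (norm_nonneg (x : K))
          simp only [Set.mem_ofPred_eq, smul_eq_mul, Subring.coe_mul, norm_mul]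
          linarith }
    else ⊥
  have hJ : ∀ ε, 0 < ε → (J ε : Set A) = Metric.ball 0 ε := by
    intro ε hε
    ext x
    simp [J, hε, ← Submodule.carrier_eq_coe]
  refine IsLinearTopology.mk_of_hasBasis A (p := fun ε : ℝ => 0 < ε) (s := J) ?_
  exact Metric.nhds_basis_ball.congr (fun _ => Iff.rfl) (fun ε hε => (hJ ε hε).symm)

variable [CompleteSpace K] {σ τ R : Type*} [Fintype σ] [Fintype τ] [CommRing R]

/-- The value of a power series at a point `z`, the coefficients being transported along `φ`. -/
noncomputable def evalPowerSeries (φ : R →+* K) (f : MvPowerSeries σ R) (z : σ → K) : K :=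
  ∑' e : σ →₀ ℕ, φ (coeff e f) * ∏ i, z i ^ e i

theorem hasEval_of_norm_lt_one {A : Subring K} {z : σ → A} (hz : ∀ i, ‖(z i : K)‖ < 1) :
    HasEval z where
  hpow i := by
    rw [IsTopologicallyNilpotent, tendsto_zero_iff_norm_tendsto_zero]
    simpa using tendsto_pow_atTop_nhds_zero_of_lt_one (norm_nonneg _) (hz i)
  tendsto_zero := by simp [cofinite_eq_bot]

/-- Both the sum and the topological evaluation of a power series at a point of the open polydisc
agree, whatever uniform structure on the coefficients makes `φ` continuous. -/
theorem hasSum_evalPowerSeries_eval₂ [UniformSpace R] [IsUniformAddGroup R]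
    [IsTopologicalSemiring R] {A : Subring K} (hA : ∀ x ∈ A, ‖x‖ ≤ 1) (hc : IsClosed (A : Set K))
    (φ : R →+* A) (hφ : Continuous φ) (f : MvPowerSeries σ R) {z : σ → A}
    (hz : ∀ i, ‖(z i : K)‖ < 1) :
    HasSum (fun e : σ →₀ ℕ => (φ (coeff e f) : K) * ∏ i, (z i : K) ^ e i) (eval₂ φ z f : A) := by
  have := isLinearTopology_of_norm_le_one hA
  have : CompleteSpace A := hc.completeSpace_coe
  have h := hasSum_eval₂ hφ (hasEval_of_norm_lt_one hz) f
  have h2 := h.map A.subtype continuous_subtype_val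
  convert h2 using 1
  · ext e
    simp [Finsupp.prod_fintype]
  · rfl

theorem norm_le_of_hasSum_of_forall_le {ι : Type*} {f : ι → K} {s : K} (h : HasSum f s) {C : ℝ}
    (hC : 0 ≤ C) (hf : ∀ i, ‖f i‖ ≤ C) : ‖s‖ ≤ C :=
  le_of_tendsto h.norm (Eventually.of_forall fun _ =>
    IsUltrametricDist.norm_sum_le_of_forall_le_of_nonneg hC fun i _ => hf i)

/-- A sum with a strictly dominant term does not vanish. -/
theorem hasSum_ne_zero_of_dominant {ι : Type*} {f : ι → K} {s : K} (h : HasSum f s) {C : ℝ}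
    (hC : 0 ≤ C) (i₀ : ι) (h₀ : C < ‖f i₀‖) (hf : ∀ i, i ≠ i₀ → ‖f i‖ ≤ C) : s ≠ 0 := by
  classical
  rintro rfl
  have h1 := h.update i₀ 0
  have h2 := norm_le_of_hasSum_of_forall_le h1 hC (fun i => by
    by_cases hi : i = i₀
    · subst hi; simpa using hC
    · simpa [Function.update_of_ne hi] using hf i hi)
  simp only [zero_sub, add_zero, norm_neg] at h2
  linarith

section

variable {φ : R →+* K} (hφ : ∀ r, ‖φ r‖ ≤ 1) {z : σ → K} (hz : ∀ i, ‖z i‖ < 1)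

/-- Evaluation of power series with coefficients bounded by one, as a ring homomorphism. -/
noncomputable def evalPowerSeriesHom : MvPowerSeries σ R →+* K :=
  -- With the discrete topology on the coefficients every `φ` is continuous.
  letI : UniformSpace R := ⊥
  haveI := isLinearTopology_of_norm_le_one (K := K) (A := closedUnitBallSubring K) fun _ h => h
  haveI : CompleteSpace (closedUnitBallSubring K) :=
    isClosed_closedUnitBallSubring.completeSpace_coe
  (closedUnitBallSubring K).subtype.comp
    (eval₂Hom (φ := φ.codRestrict (closedUnitBallSubring K) hφ) continuous_of_discreteTopology
      (hasEval_of_norm_lt_one (z := fun i => ⟨z i, (hz i).le⟩) hz))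

theorem hasSum_evalPowerSeriesHom (f : MvPowerSeries σ R) :
    HasSum (fun e : σ →₀ ℕ => φ (coeff e f) * ∏ i, z i ^ e i) (evalPowerSeriesHom hφ hz f) := by
  let : UniformSpace R := ⊥
  have := isLinearTopology_of_norm_le_one (K := K) (A := closedUnitBallSubring K) fun _ h => h
  have : CompleteSpace (closedUnitBallSubring K) :=
    isClosed_closedUnitBallSubring.completeSpace_coe
  have h := hasSum_evalPowerSeries_eval₂ (K := K) (A := closedUnitBallSubring K) (fun _ h => h)
    isClosed_closedUnitBallSubring (φ.codRestrict (closedUnitBallSubring K) hφ)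
    continuous_of_discreteTopology f (z := fun i => ⟨z i, (hz i).le⟩) hz
  rw [← coe_eval₂Hom continuous_of_discreteTopology (hasEval_of_norm_lt_one hz)] at h
  exact h

theorem coe_evalPowerSeriesHom (f : MvPowerSeries σ R) :
    evalPowerSeriesHom hφ hz f = evalPowerSeries φ f z :=
  (hasSum_evalPowerSeriesHom hφ hz f).tsum_eq.symm

include hφ hz

theorem hasSum_evalPowerSeries (f : MvPowerSeries σ R) :
    HasSum (fun e : σ →₀ ℕ => φ (coeff e f) * ∏ i, z i ^ e i) (evalPowerSeries φ f z) :=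
  coe_evalPowerSeriesHom hφ hz f ▸ hasSum_evalPowerSeriesHom hφ hz f

theorem evalPowerSeries_add (f g : MvPowerSeries σ R) :
    evalPowerSeries φ (f + g) z = evalPowerSeries φ f z + evalPowerSeries φ g z := by
  simp only [← coe_evalPowerSeriesHom hφ hz, map_add]

theorem evalPowerSeries_sub (f g : MvPowerSeries σ R) :
    evalPowerSeries φ (f - g) z = evalPowerSeries φ f z - evalPowerSeries φ g z := by
  simp only [← coe_evalPowerSeriesHom hφ hz, map_sub]

theorem evalPowerSeries_mul (f g : MvPowerSeries σ R) :
    evalPowerSeries φ (f * g) z = evalPowerSeries φ f z * evalPowerSeries φ g z := by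
  simp only [← coe_evalPowerSeriesHom hφ hz, map_mul]

theorem evalPowerSeries_one : evalPowerSeries φ (1 : MvPowerSeries σ R) z = 1 := by
  simp only [← coe_evalPowerSeriesHom hφ hz, map_one]

theorem evalPowerSeries_C (r : R) : evalPowerSeries φ (C r : MvPowerSeries σ R) z = φ r := by
  classical
  rw [evalPowerSeries, tsum_eq_single 0]
  · simp
  · intro e he
    simp [coeff_C, he]

theorem evalPowerSeries_X (i : σ) : evalPowerSeries φ (X i : MvPowerSeries σ R) z = z i := by
  classical
  rw [evalPowerSeries, tsum_eq_single (Finsupp.single i 1)]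
  · rw [Finset.prod_eq_single i]
    · simp
    · intro j _ hj
      simp [hj.symm]
    · simp
  · intro e he
    simp [coeff_X, he]

theorem norm_evalPowerSeries_le (f : MvPowerSeries σ R) {r : ℝ} (hr : 0 ≤ r)
    (hzr : ∀ i, ‖z i‖ ≤ r) (h0 : ‖φ (constantCoeff f)‖ ≤ r) : ‖evalPowerSeries φ f z‖ ≤ r := by
  classical
  refine norm_le_of_hasSum_of_forall_le (hasSum_evalPowerSeries hφ hz f) hr fun e => ?_
  by_cases he : e = 0
  · subst he
    simpa using h0
  · obtain ⟨i, hi⟩ := Finsupp.ne_iff.mp he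
    have h1 : ∏ j, ‖z j ^ e j‖ ≤ ‖z i‖ := by
      rw [← Finset.mul_prod_erase _ _ (Finset.mem_univ i)]
      have h2 : ∏ j ∈ Finset.univ.erase i, ‖z j ^ e j‖ ≤ 1 :=
        Finset.prod_le_one (fun _ _ => norm_nonneg _) fun j _ => by
          rw [norm_pow]; exact pow_le_one₀ (norm_nonneg _) (hz j).le
      have h3 : ‖z i ^ e i‖ ≤ ‖z i‖ := by
        rw [norm_pow]
        exact pow_le_of_le_one (norm_nonneg _) (hz i).le (by simpa using hi)
      calc _ ≤ ‖z i‖ * 1 := mul_le_mul h3 h2 (Finset.prod_nonneg fun _ _ => norm_nonneg _)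
            (norm_nonneg _)
        _ = _ := mul_one _
    rw [norm_mul, norm_prod]
    calc _ ≤ 1 * ‖z i‖ := mul_le_mul (hφ _) h1 (Finset.prod_nonneg fun _ _ => norm_nonneg _)
          zero_le_one
      _ ≤ r := by simpa using hzr i

theorem norm_evalPowerSeries_lt_one (f : MvPowerSeries σ R) (h0 : ‖φ (constantCoeff f)‖ < 1) :
    ‖evalPowerSeries φ f z‖ < 1 := by
  -- Termwise strict bounds need not survive in an infinite sum, so a uniform `r < 1` is chosen.
  obtain ⟨r, hr, hr1⟩ : ∃ r : ℝ, (‖φ (constantCoeff f)‖ ≤ r ∧ ∀ i, ‖z i‖ ≤ r) ∧ r < 1 := by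
    refine ⟨max ‖φ (constantCoeff f)‖ (‖z‖), ⟨le_max_left _ _, fun i =>
      (norm_le_pi_norm z i).trans (le_max_right _ _)⟩, max_lt h0 ?_⟩
    exact (pi_norm_lt_iff one_pos).mpr hz
  exact (norm_evalPowerSeries_le hφ hz f ((norm_nonneg _).trans hr.1) hr.2 hr.1).trans_lt hr1

theorem evalPowerSeries_subst {υ : Type*} [Fintype υ] {a : υ → MvPowerSeries σ R}
    (ha : ∀ s, constantCoeff (a s) = 0) (f : MvPowerSeries υ R) :
    evalPowerSeries φ (subst a f) z =
      evalPowerSeries φ f (fun s => evalPowerSeries φ (a s) z) := by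
  have hA : ∀ x ∈ closedUnitBallSubring K, ‖x‖ ≤ 1 := fun _ h => h
  let : UniformSpace R := ⊥
  have := isLinearTopology_of_norm_le_one hA
  have : CompleteSpace (closedUnitBallSubring K) :=
    isClosed_closedUnitBallSubring.completeSpace_coe
  let : Algebra R (closedUnitBallSubring K) :=
    (φ.codRestrict (closedUnitBallSubring K) hφ).toAlgebra
  let w : σ → closedUnitBallSubring K := fun i => ⟨z i, (hz i).le⟩
  have hcont : Continuous (algebraMap R (closedUnitBallSubring K)) :=
    continuous_of_discreteTopology
  have key := eval₂_subst (R := R) (hasSubst_of_constantCoeff_zero ha)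
    (hasEval_of_norm_lt_one (z := w) hz) f
  have h1 : ∀ g : MvPowerSeries σ R,
      ((eval₂ (algebraMap R (closedUnitBallSubring K)) w g : closedUnitBallSubring K) : K) = evalPowerSeries φ g z := fun g =>
    (hasSum_evalPowerSeries_eval₂ hA isClosed_closedUnitBallSubring _ hcont g hz).tsum_eq.symm
  have h2 := hasSum_evalPowerSeries_eval₂ hA isClosed_closedUnitBallSubring _ hcont f
    (z := fun s => eval₂ (algebraMap R (closedUnitBallSubring K)) w (a s)) (fun s => by
      rw [h1]
      exact norm_evalPowerSeries_lt_one hφ hz _ (by simp [ha]))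
  rw [← h1, key, ← h2.tsum_eq]
  simp only [h1]
  rfl

omit hφ hz in
open scoped WithPiTopology in
/-- Evaluation of a power series at power series whose constant coefficients are topologically
nilpotent is again given by a power series. -/
theorem exists_evalPowerSeries_comp [UniformSpace R] [IsUniformAddGroup R]
    [IsTopologicalSemiring R] {A : Subring K} (hA : ∀ x ∈ A, ‖x‖ ≤ 1) (hc : IsClosed (A : Set K))
    (θ : R →+* A) (hθ : Continuous θ) (f : MvPowerSeries σ R) (a : σ → MvPowerSeries τ A)
    (ha : ∀ s, ‖((constantCoeff (a s) : A) : K)‖ < 1) :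
    ∃ G : MvPowerSeries τ A, ∀ z : τ → K, (∀ i, ‖z i‖ < 1) →
      evalPowerSeries A.subtype G z =
        evalPowerSeries (A.subtype.comp θ) f (fun s => evalPowerSeries A.subtype (a s) z) := by
  have := isLinearTopology_of_norm_le_one hA
  have : CompleteSpace A := hc.completeSpace_coe
  have hev : HasEval a :=
    { hpow := fun s => LinearTopology.isTopologicallyNilpotent_of_constantCoeff <| by
        rw [IsTopologicallyNilpotent, tendsto_zero_iff_norm_tendsto_zero]
        simpa using tendsto_pow_atTop_nhds_zero_of_lt_one (norm_nonneg _) (ha s)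
      tendsto_zero := by simp [cofinite_eq_bot] }
  have hCθ : Continuous ((C (σ := τ) (R := A)).comp θ) := (WithPiTopology.continuous_C (σ := τ) (R := A)).comp hθ
  refine ⟨eval₂ ((C (σ := τ) (R := A)).comp θ) a f, fun z hz => ?_⟩
  have hB : ∀ x ∈ closedUnitBallSubring K, ‖x‖ ≤ 1 := fun _ h => h
  have := isLinearTopology_of_norm_le_one hB
  have : CompleteSpace (closedUnitBallSubring K) :=
    isClosed_closedUnitBallSubring.completeSpace_coe
  -- The coordinates of `z` need not lie in `A`, so evaluation at `z` takes values in the larger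
  -- ring.
  have hAB : A ≤ closedUnitBallSubring K := hA
  have hi : Continuous (Subring.inclusion hAB) := continuous_inclusion hAB
  let w : τ → closedUnitBallSubring K := fun i => ⟨z i, (hz i).le⟩
  have hw : HasEval w := hasEval_of_norm_lt_one (z := w) hz
  -- Evaluation at `z` is a continuous ring homomorphism and therefore commutes with the infinite
  -- sum defining the composite.
  have key := congrFun (comp_eval₂ hCθ hev (ε := eval₂Hom hi hw)
    (by rw [coe_eval₂Hom]; exact continuous_eval₂ hi hw)) f
  have hcomp : (eval₂Hom hi hw).comp ((C (σ := τ) (R := A)).comp θ) =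
      (Subring.inclusion hAB).comp θ := by
    ext r
    simp [coe_eval₂Hom]
  have h1 : ∀ g : MvPowerSeries τ A,
      ((eval₂ (Subring.inclusion hAB) w g : closedUnitBallSubring K) : K) = evalPowerSeries A.subtype g z := fun g =>
    (hasSum_evalPowerSeries_eval₂ hB isClosed_closedUnitBallSubring _ hi g hz).tsum_eq.symm
  rw [hcomp, Function.comp_apply, coe_eval₂Hom] at key
  rw [← h1, key]
  have h2 := hasSum_evalPowerSeries_eval₂ hB isClosed_closedUnitBallSubring
    ((Subring.inclusion hAB).comp θ) (hi.comp hθ) f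
    (z := eval₂ (Subring.inclusion hAB) w ∘ a) (fun s => by
      rw [Function.comp_apply, h1]
      exact norm_evalPowerSeries_lt_one (fun r => hA _ r.2) hz _ (ha s))
  rw [← h2.tsum_eq]
  simp only [h1, Function.comp_apply]
  rfl

end

end PowerSeriesEvaluation

/-! ### Powers of one-units with `p`-adic exponents. -/

section OneUnitPowers

open MvPowerSeries Filter Topology

variable (p : ℕ) [Fact p.Prime]

/-- The inclusion of the `p`-adic integers into `ℂ_[p]` as a ring homomorphism. -/
noncomputable def padicIntHom : ℤ_[p] →+* ℂ_[p] :=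
  (algebraMap ℚ_[p] ℂ_[p]).comp PadicInt.Coe.ringHom

theorem padicIntHom_apply (a : ℤ_[p]) : padicIntHom p a = padicIntToComplex p a := rfl

theorem padicEval_eq_evalPowerSeries {n : ℕ} (f : MvPowerSeries (Fin n) ℤ_[p])
    (z : Fin n → ℂ_[p]) : padicEval p f z = evalPowerSeries (padicIntHom p) f z := rfl

theorem norm_padicIntHom (a : ℤ_[p]) : ‖padicIntHom p a‖ = ‖a‖ :=
  PadicComplex.norm_extends' p (a : ℚ_[p])

theorem norm_padicIntHom_le_one (a : ℤ_[p]) : ‖padicIntHom p a‖ ≤ 1 :=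
  (norm_padicIntHom p a).trans_le a.norm_le_one

theorem continuous_padicIntHom : Continuous (padicIntHom p) :=
  (AddMonoidHomClass.isometry_of_norm (padicIntHom p) (norm_padicIntHom p)).continuous

theorem padicIntHom_injective : Function.Injective (padicIntHom p) :=
  (AddMonoidHomClass.isometry_of_norm (padicIntHom p) (norm_padicIntHom p)).injective

variable {p}

/-- The power `u ^ j` of a one-unit `u` (that is, `‖u - 1‖ < 1`) with `p`-adic exponent `j`. -/
noncomputable def oneUnitPow (u : ℂ_[p]) (j : ℤ_[p]) : ℂ_[p] :=
  ∑' n : ℕ, padicIntHom p (Ring.choose j n) * (u - 1) ^ n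

theorem norm_oneUnitPow_term_le (u : ℂ_[p]) (j : ℤ_[p]) (n : ℕ) :
    ‖padicIntHom p (Ring.choose j n) * (u - 1) ^ n‖ ≤ ‖u - 1‖ ^ n := by
  rw [norm_mul, norm_pow]
  exact mul_le_of_le_one_left (by positivity) (norm_padicIntHom_le_one p _)

theorem hasSum_oneUnitPow {u : ℂ_[p]} (hu : ‖u - 1‖ < 1) (j : ℤ_[p]) :
    HasSum (fun n : ℕ => padicIntHom p (Ring.choose j n) * (u - 1) ^ n) (oneUnitPow u j) :=
  (Summable.of_norm_bounded (summable_geometric_of_lt_one (norm_nonneg _) hu)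
    (norm_oneUnitPow_term_le u j)).hasSum

/-- Binomial coefficients are continuous in the exponent, and one geometric series majorizes the
terms for all exponents. -/
theorem continuous_oneUnitPow {u : ℂ_[p]} (hu : ‖u - 1‖ < 1) : Continuous (oneUnitPow u) :=
  continuous_tsum
    (fun n => ((continuous_padicIntHom p).comp (PadicInt.continuous_choose n)).mul
      continuous_const)
    (summable_geometric_of_lt_one (norm_nonneg _) hu) fun n j => norm_oneUnitPow_term_le u j n

theorem oneUnitPow_natCast (u : ℂ_[p]) (n : ℕ) : oneUnitPow u (n : ℤ_[p]) = u ^ n := by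
  rw [oneUnitPow, tsum_eq_sum (s := Finset.range (n + 1))]
  · conv_rhs => rw [← sub_add_cancel u 1, add_pow]
    refine Finset.sum_congr rfl fun k _ => ?_
    simp [Ring.choose_natCast, mul_comm]
  · intro k hk
    rw [Ring.choose_natCast, Nat.choose_eq_zero_of_lt (by simpa using hk)]
    simp

/-- Density of `ℕ` in `ℤ_p`: the power laws below are reduced by it to natural exponents. -/
theorem eq_of_forall_natCast_eq {X : Type*} [TopologicalSpace X] [T2Space X] {f g : ℤ_[p] → X}
    (hf : Continuous f) (hg : Continuous g) (h : ∀ n : ℕ, f n = g n) : f = g :=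
  PadicInt.denseRange_natCast.equalizer hf hg (funext h)

theorem norm_oneUnitPow_sub_one_le {u : ℂ_[p]} (hu : ‖u - 1‖ < 1) (j : ℤ_[p]) :
    ‖oneUnitPow u j - 1‖ ≤ ‖u - 1‖ := by
  have h := (hasSum_oneUnitPow hu j).update 0 0
  simp only [Ring.choose_zero_right, map_one, pow_zero, mul_one] at h
  rw [zero_sub, neg_add_eq_sub] at h
  refine norm_le_of_hasSum_of_forall_le h (norm_nonneg _) fun n => ?_
  rcases n with _ | n
  · simp
  · rw [Function.update_of_ne (by simp)]
    refine (norm_oneUnitPow_term_le u j _).trans ?_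
    exact pow_le_of_le_one (norm_nonneg _) hu.le (by simp)

theorem norm_oneUnitPow_sub_one_lt {u : ℂ_[p]} (hu : ‖u - 1‖ < 1) (j : ℤ_[p]) :
    ‖oneUnitPow u j - 1‖ < 1 := (norm_oneUnitPow_sub_one_le hu j).trans_lt hu

theorem norm_one_unit {u : ℂ_[p]} (hu : ‖u - 1‖ < 1) : ‖u‖ = 1 := by
  have h := IsUltrametricDist.norm_add_eq_max_of_norm_ne_norm (x := u - 1) (y := 1)
    (by rw [norm_one]; exact hu.ne)
  rw [sub_add_cancel, norm_one, max_eq_right hu.le] at h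
  exact h

theorem norm_mul_sub_one_lt {u v : ℂ_[p]} (hu : ‖u - 1‖ < 1) (hv : ‖v - 1‖ < 1) :
    ‖u * v - 1‖ < 1 := by
  have h : u * v - 1 = (u - 1) * v + (v - 1) := by ring
  rw [h]
  refine (IsUltrametricDist.norm_add_le_max _ _).trans_lt (max_lt ?_ hv)
  rw [norm_mul, norm_one_unit hv, mul_one]
  exact hu

theorem norm_pow_sub_one_lt {u : ℂ_[p]} (hu : ‖u - 1‖ < 1) (n : ℕ) : ‖u ^ n - 1‖ < 1 := by
  rw [← oneUnitPow_natCast]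
  exact norm_oneUnitPow_sub_one_lt hu _

theorem oneUnitPow_zero (u : ℂ_[p]) : oneUnitPow u 0 = 1 := by
  simpa using oneUnitPow_natCast u 0

theorem oneUnitPow_one (u : ℂ_[p]) : oneUnitPow u 1 = u := by
  simpa using oneUnitPow_natCast u 1

theorem one_oneUnitPow (j : ℤ_[p]) : oneUnitPow (1 : ℂ_[p]) j = 1 := by
  have h := norm_oneUnitPow_sub_one_le (u := (1 : ℂ_[p])) (by simp) j
  rw [sub_self, norm_zero, norm_le_zero_iff, sub_eq_zero] at h
  exact h

theorem oneUnitPow_add {u : ℂ_[p]} (hu : ‖u - 1‖ < 1) (i j : ℤ_[p]) :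
    oneUnitPow u (i + j) = oneUnitPow u i * oneUnitPow u j := by
  have hc := continuous_oneUnitPow hu
  have h1 : ∀ m : ℕ, ∀ j : ℤ_[p], oneUnitPow u (m + j) = oneUnitPow u m * oneUnitPow u j := fun m =>
    congrFun <| eq_of_forall_natCast_eq (f := fun j : ℤ_[p] => oneUnitPow u (m + j))
      (g := fun j => oneUnitPow u m * oneUnitPow u j) (by fun_prop) (by fun_prop) fun n => by
        rw [← Nat.cast_add]
        simp only [oneUnitPow_natCast, pow_add]
  exact congrFun (eq_of_forall_natCast_eq (f := fun i => oneUnitPow u (i + j))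
      (g := fun i => oneUnitPow u i * oneUnitPow u j) (by fun_prop) (by fun_prop)
      fun m => h1 m j) i

theorem mul_oneUnitPow {u v : ℂ_[p]} (hu : ‖u - 1‖ < 1) (hv : ‖v - 1‖ < 1) (j : ℤ_[p]) :
    oneUnitPow (u * v) j = oneUnitPow u j * oneUnitPow v j :=
  congrFun (eq_of_forall_natCast_eq (continuous_oneUnitPow (norm_mul_sub_one_lt hu hv))
    ((continuous_oneUnitPow hu).mul (continuous_oneUnitPow hv)) fun n => by
      simp only [Pi.mul_apply, oneUnitPow_natCast, mul_pow]) j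

theorem oneUnitPow_ne_zero {u : ℂ_[p]} (hu : ‖u - 1‖ < 1) (j : ℤ_[p]) : oneUnitPow u j ≠ 0 := by
  rw [← norm_ne_zero_iff, norm_one_unit (norm_oneUnitPow_sub_one_lt hu j)]
  exact one_ne_zero

theorem oneUnitPow_neg {u : ℂ_[p]} (hu : ‖u - 1‖ < 1) (j : ℤ_[p]) :
    oneUnitPow u (-j) = (oneUnitPow u j)⁻¹ := by
  refine eq_inv_of_mul_eq_one_left ?_
  rw [← oneUnitPow_add hu, neg_add_cancel, oneUnitPow_zero]

theorem oneUnitPow_mul {u : ℂ_[p]} (hu : ‖u - 1‖ < 1) (i j : ℤ_[p]) :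
    oneUnitPow u (i * j) = oneUnitPow (oneUnitPow u i) j := by
  have hc := continuous_oneUnitPow hu
  refine congrFun (eq_of_forall_natCast_eq (f := fun j => oneUnitPow u (i * j)) (by fun_prop)
    (continuous_oneUnitPow (norm_oneUnitPow_sub_one_lt hu i)) fun n => ?_) j
  rw [oneUnitPow_natCast]
  induction n with
  | zero => simp [oneUnitPow_zero]
  | succ n ih => rw [Nat.cast_succ, mul_add, mul_one, oneUnitPow_add hu, ih, pow_succ]

theorem oneUnitPow_natCast_mul {u : ℂ_[p]} (hu : ‖u - 1‖ < 1) (n : ℕ) (j : ℤ_[p]) :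
    oneUnitPow u (n * j) = oneUnitPow (u ^ n) j := by
  rw [oneUnitPow_mul hu, oneUnitPow_natCast]

theorem oneUnitPow_pow {u : ℂ_[p]} (hu : ‖u - 1‖ < 1) (n : ℕ) (j : ℤ_[p]) :
    oneUnitPow u j ^ n = oneUnitPow (u ^ n) j := by
  rw [← oneUnitPow_natCast_mul hu, mul_comm, oneUnitPow_mul hu, oneUnitPow_natCast]

/-- The power series `(1 + X) ^ j` with `p`-adic exponent `j`. -/
noncomputable def binomialPowerSeries (j : ℤ_[p]) : MvPowerSeries (Fin 1) ℤ_[p] :=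
  fun e => Ring.choose j (e 0)

theorem coeff_binomialPowerSeries (j : ℤ_[p]) (e : Fin 1 →₀ ℕ) :
    coeff e (binomialPowerSeries j) = Ring.choose j (e 0) := rfl

theorem constantCoeff_binomialPowerSeries (j : ℤ_[p]) :
    constantCoeff (binomialPowerSeries j) = 1 := by
  rw [← coeff_zero_eq_constantCoeff_apply, coeff_binomialPowerSeries]
  simp

theorem binomialPowerSeries_natCast (n : ℕ) :
    binomialPowerSeries (n : ℤ_[p]) = (1 + X 0) ^ n := by
  classical
  ext e
  rw [add_comm, add_pow, coeff_binomialPowerSeries, map_sum, Ring.choose_natCast]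
  have h : ∀ k : ℕ, coeff e ((X 0 : MvPowerSeries (Fin 1) ℤ_[p]) ^ k * 1 ^ (n - k) *
      ((n.choose k : ℕ) : MvPowerSeries (Fin 1) ℤ_[p])) =
      if e 0 = k then ((n.choose k : ℕ) : ℤ_[p]) else 0 := by
    intro k
    rw [one_pow, mul_one, ← map_natCast (C (σ := Fin 1) (R := ℤ_[p])), coeff_mul_C, coeff_X_pow]
    have : e = Finsupp.single 0 k ↔ e 0 = k := by
      constructor
      · rintro rfl; simp
      · intro h; ext; simpa using h
    simp [this]
  simp only [h, Finset.sum_ite_eq, Finset.mem_range]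
  split_ifs with hk
  · rfl
  · rw [Nat.choose_eq_zero_of_lt (by omega), Nat.cast_zero]

theorem evalPowerSeries_binomialPowerSeries (j : ℤ_[p]) (z : Fin 1 → ℂ_[p]) :
    evalPowerSeries (padicIntHom p) (binomialPowerSeries j) z = oneUnitPow (1 + z 0) j := by
  rw [evalPowerSeries, oneUnitPow, ← (Finsupp.equivFunOnFinite.trans
    (Equiv.funUnique (Fin 1) ℕ)).symm.tsum_eq]
  refine tsum_congr fun n => ?_
  simp [coeff_binomialPowerSeries]

end OneUnitPowers

/-! ### Binomial series as homomorphisms, and the one-dimensional subtori they define. -/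

section LineSubtori

open MvPowerSeries Filter Topology

variable {p : ℕ} [Fact p.Prime]

/-- Each coefficient of a substituted series depends on finitely many coefficients of the original
one. The series with all coefficients one exhibits a finite set of exponents that serves every `j`.
-/
theorem continuous_coeff_subst {σ τ : Type*} {a : σ → MvPowerSeries τ ℤ_[p]} (ha : HasSubst a)
    {f : ℤ_[p] → MvPowerSeries σ ℤ_[p]} (hf : ∀ e, Continuous fun j => coeff e (f j))
    (e : τ →₀ ℕ) : Continuous fun j => coeff e (subst a (f j)) := by
  obtain ⟨g, hg⟩ : ∃ g : MvPowerSeries σ ℤ_[p], ∀ d, coeff d g = 1 := ⟨fun _ => 1, fun _ => rfl⟩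
  have hfin : (Function.support fun d =>
      coeff d g • coeff e (d.prod fun s n => a s ^ n)).Finite := coeff_subst_finite ha g e
  have h : ∀ j, coeff e (subst a (f j)) = ∑ d ∈ Set.Finite.toFinset hfin,
      coeff d (f j) • coeff e (d.prod fun s n => a s ^ n) := by
    intro j
    rw [coeff_subst ha, finsum_eq_sum_of_support_subset]
    intro d hd
    rw [Function.mem_support] at hd
    rw [Finset.mem_coe, Set.Finite.mem_toFinset, Function.mem_support]
    rw [hg, one_smul]
    intro h1
    exact hd (by rw [h1, smul_zero])
  simp only [h, smul_eq_mul]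
  fun_prop

theorem continuous_coeff_mul {σ : Type*} {f g : ℤ_[p] → MvPowerSeries σ ℤ_[p]}
    (hf : ∀ e, Continuous fun j => coeff e (f j)) (hg : ∀ e, Continuous fun j => coeff e (g j))
    (e : σ →₀ ℕ) : Continuous fun j => coeff e (f j * g j) := by
  classical
  simp only [coeff_mul]
  fun_prop

theorem subst_multiplicative_law {R σ : Type*} [CommRing R] (a b : MvPowerSeries σ R)
    (ha : constantCoeff a = 0) (hb : constantCoeff b = 0) :
    (FormalGroup.𝔾ₘ : FormalGroup R).toPowerSeries.subst ![a, b] = a + b + a * b := by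
  have h : HasSubst ![a, b] := hasSubst_of_constantCoeff_zero fun s => by
    fin_cases s <;> simp [ha, hb]
  simp [FormalGroup.𝔾ₘ, subst_add h, subst_mul h, subst_X h]

theorem formalTorusLaw_apply {R : Type*} [CommRing R] {m : ℕ} (i : Fin m) :
    formalTorusLaw R m i = X (Sum.inl i) + X (Sum.inr i) + X (Sum.inl i) * X (Sum.inr i) :=
  subst_multiplicative_law _ _ (by simp) (by simp)

theorem constantCoeff_formalTorusLaw {R : Type*} [CommRing R] {m : ℕ} (i : Fin m) :
    constantCoeff (formalTorusLaw R m i) = 0 := by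
  simp [formalTorusLaw_apply]

/-- The law `(1 + X + Y + X Y) ^ j = (1 + X) ^ j (1 + Y) ^ j` of formal power series. -/
theorem subst_formalTorusLaw_binomialPowerSeries (j : ℤ_[p]) :
    subst (formalTorusLaw ℤ_[p] 1) (binomialPowerSeries j) =
      subst (fun i => (X (Sum.inl i) : MvPowerSeries (Fin 1 ⊕ Fin 1) ℤ_[p]))
        (binomialPowerSeries j) *
      subst (fun i => (X (Sum.inr i) : MvPowerSeries (Fin 1 ⊕ Fin 1) ℤ_[p]))
        (binomialPowerSeries j) := by
  have h0 : HasSubst (formalTorusLaw ℤ_[p] 1) :=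
    hasSubst_of_constantCoeff_zero constantCoeff_formalTorusLaw
  have h1 : HasSubst fun i => (X (Sum.inl i) : MvPowerSeries (Fin 1 ⊕ Fin 1) ℤ_[p]) :=
    hasSubst_of_constantCoeff_zero fun _ => by simp
  have h2 : HasSubst fun i => (X (Sum.inr i) : MvPowerSeries (Fin 1 ⊕ Fin 1) ℤ_[p]) :=
    hasSubst_of_constantCoeff_zero fun _ => by simp
  have hc : ∀ e : Fin 1 →₀ ℕ, Continuous fun j : ℤ_[p] => coeff e (binomialPowerSeries j) :=
    fun e => PadicInt.continuous_choose _
  ext e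
  refine congrFun (eq_of_forall_natCast_eq (continuous_coeff_subst h0 hc e)
    (continuous_coeff_mul (fun e => continuous_coeff_subst h1 hc e)
      (fun e => continuous_coeff_subst h2 hc e) e) fun n => ?_) j
  congr 1
  simp only [binomialPowerSeries_natCast, ← coe_substAlgHom h0, ← coe_substAlgHom h1,
    ← coe_substAlgHom h2, map_pow, map_add, map_one, substAlgHom_X, ← mul_pow,
    formalTorusLaw_apply]
  congr 1
  ring

/-- A series whose shift by one is multiplicative satisfies the homomorphism law. -/
theorem map_law_of_subst_mul {m : ℕ} (f : MvPowerSeries (Fin m) ℤ_[p])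
    (h0 : constantCoeff f = 1)
    (hf : subst (formalTorusLaw ℤ_[p] m) f =
      subst (fun i => (X (Sum.inl i) : MvPowerSeries (Fin m ⊕ Fin m) ℤ_[p])) f *
      subst (fun i => (X (Sum.inr i) : MvPowerSeries (Fin m ⊕ Fin m) ℤ_[p])) f) :
    subst (formalTorusLaw ℤ_[p] m) (f - 1) =
      (FormalGroup.𝔾ₘ : FormalGroup ℤ_[p]).toPowerSeries.subst
        ![subst (fun j => (X (Sum.inl j) : MvPowerSeries (Fin m ⊕ Fin m) ℤ_[p])) (f - 1),
          subst (fun j => (X (Sum.inr j) : MvPowerSeries (Fin m ⊕ Fin m) ℤ_[p])) (f - 1)] := by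
  have hl : HasSubst (formalTorusLaw ℤ_[p] m) :=
    hasSubst_of_constantCoeff_zero constantCoeff_formalTorusLaw
  have h1 : HasSubst fun i => (X (Sum.inl i) : MvPowerSeries (Fin m ⊕ Fin m) ℤ_[p]) :=
    hasSubst_of_constantCoeff_zero fun _ => by simp
  have h2 : HasSubst fun i => (X (Sum.inr i) : MvPowerSeries (Fin m ⊕ Fin m) ℤ_[p]) :=
    hasSubst_of_constantCoeff_zero fun _ => by simp
  rw [subst_multiplicative_law _ _
    (constantCoeff_subst_eq_zero h1 (fun _ => by simp) (by simp [h0]))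
    (constantCoeff_subst_eq_zero h2 (fun _ => by simp) (by simp [h0]))]
  have hone : ∀ {a : Fin m → MvPowerSeries (Fin m ⊕ Fin m) ℤ_[p]}, HasSubst a →
      subst a (1 : MvPowerSeries (Fin m) ℤ_[p]) = 1 := fun ha => by
    rw [← coe_substAlgHom ha, map_one]
  rw [subst_sub hl, subst_sub h1, subst_sub h2, hf, hone hl, hone h1, hone h2]
  ring

/-- The one-dimensional formal subtorus of `𝔾ₘ²` of all `((1 + t) ^ i - 1, (1 + t) ^ j - 1)`, where
one of the exponents is one. -/
noncomputable def lineSubtorus (v : Fin 2 → ℤ_[p]) (i₀ : Fin 2) (hv : v i₀ = 1) :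
    FormalSubtorus ℤ_[p] 2 1 where
  toSeries i := binomialPowerSeries (v i) - 1
  constantCoeff_eq_zero i := by simp [constantCoeff_binomialPowerSeries]
  map_law i := map_law_of_subst_mul _ (constantCoeff_binomialPowerSeries _)
    (subst_formalTorusLaw_binomialPowerSeries _)
  surjective g := by
    have h : HasSubst fun i => (binomialPowerSeries (v i) - 1 : MvPowerSeries (Fin 1) ℤ_[p]) :=
      hasSubst_of_constantCoeff_zero fun i => by simp [constantCoeff_binomialPowerSeries]
    have h1 : HasSubst fun _ : Fin 1 => (X i₀ : MvPowerSeries (Fin 2) ℤ_[p]) :=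
      hasSubst_of_constantCoeff_zero fun i => by simp
    -- Coordinate `i₀` of the embedding is the variable itself, because its exponent is one; hence
    -- `X i₀` gives a preimage.
    refine ⟨subst (fun _ => X i₀) g, ?_⟩
    dsimp only
    rw [subst_comp_subst_apply h1 h]
    have h2 : (fun _ : Fin 1 => subst (fun i => (binomialPowerSeries (v i) - 1 :
        MvPowerSeries (Fin 1) ℤ_[p])) (X i₀ : MvPowerSeries (Fin 2) ℤ_[p])) = X := by
      ext1 k
      rw [subst_X h, hv, Fin.fin_one_eq_zero k]
      have := binomialPowerSeries_natCast (p := p) 1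
      rw [Nat.cast_one, pow_one] at this
      rw [this, add_sub_cancel_left]
    rw [h2, subst_self, id]

theorem vanishesAlongTranslate_lineSubtorus {v : Fin 2 → ℤ_[p]} {i₀ : Fin 2} (hv : v i₀ = 1)
    (L : MvPowerSeries (Fin 2) ℤ_[p]) (P : Fin 2 → ℂ_[p])
    (h : ∀ u : ℂ_[p], ‖u - 1‖ < 1 → evalPowerSeries (padicIntHom p) L
      (fun i => (1 + P i) * oneUnitPow u (v i) - 1) = 0) :
    VanishesAlongTranslate p L P (lineSubtorus v i₀ hv) := by
  intro z hz
  convert h (1 + z 0) (by simpa using hz 0) using 1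
  rw [padicEval_eq_evalPowerSeries]
  congr 1
  ext1 i
  rw [padicEval_eq_evalPowerSeries]
  change P i + evalPowerSeries _ (binomialPowerSeries (v i) - 1) z +
    P i * evalPowerSeries _ (binomialPowerSeries (v i) - 1) z = _
  rw [evalPowerSeries_sub (norm_padicIntHom_le_one p) hz,
    evalPowerSeries_one (norm_padicIntHom_le_one p) hz, evalPowerSeries_binomialPowerSeries]
  ring

end LineSubtori

/-! ### Nonvanishing of power series by a strictly dominant monomial. -/

section Dominance

open MvPowerSeries Filter Topology

variable {K : Type*} [NormedField K] [IsUltrametricDist K] {A : Subring K}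

/-- In a compact subset of an ultrametric field the norms are discrete away from zero. -/
theorem finite_norms_of_isCompact (hA : IsCompact (A : Set K)) {ε : ℝ} (hε : 0 < ε) :
    ((fun a : K => ‖a‖) '' {a ∈ (A : Set K) | ε ≤ ‖a‖}).Finite := by
  have hc : IsCompact {a ∈ (A : Set K) | ε ≤ ‖a‖} :=
    hA.inter_right (isClosed_le continuous_const continuous_norm)
  obtain ⟨t, ht, hcov⟩ := hc.elim_nhds_subcover (fun a => Metric.ball a ε)
    fun a _ => Metric.ball_mem_nhds a hε
  refine ((t.finite_toSet).image fun a : K => ‖a‖).subset ?_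
  rintro _ ⟨a, ha, rfl⟩
  obtain ⟨b, hb, hab⟩ := Set.mem_iUnion₂.mp (hcov ha)
  -- On a ball of radius `ε` around a point of norm at least `ε` the norm is constant, so the
  -- centres already show all norms.
  refine ⟨b, hb, ?_⟩
  have hb' := (ht b hb).2
  rw [Metric.mem_ball, dist_eq_norm] at hab
  have h := IsUltrametricDist.norm_add_eq_max_of_norm_ne_norm (x := a - b) (y := b)
    (hab.trans_le hb').ne
  rw [sub_add_cancel, max_eq_right (hab.trans_le hb').le] at h
  exact h.symm

/-- A nonzero family in a compact subring attains its largest norm `M`, and the smaller norms stay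
below some `M' < M`. -/
theorem exists_norm_gap (hA : IsCompact (A : Set K)) {ι : Type*} (c : ι → A)
    (hc : ∃ e, c e ≠ 0) :
    ∃ M M' : ℝ, 0 < M' ∧ M' < M ∧ (∃ e, ‖(c e : K)‖ = M) ∧
      ∀ e, ‖(c e : K)‖ = M ∨ ‖(c e : K)‖ ≤ M' := by
  obtain ⟨e₀, he₀⟩ := hc
  have hε : 0 < ‖(c e₀ : K)‖ := by simpa using he₀
  have hfin := finite_norms_of_isCompact hA (half_pos hε)
  set T := {r : ℝ | ∃ e, r = ‖(c e : K)‖ ∧ ‖(c e₀ : K)‖ / 2 ≤ r} with hT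
  have hTfin : T.Finite := hfin.subset (by
    rintro _ ⟨e, rfl, h⟩
    exact ⟨c e, ⟨(c e).2, h⟩, rfl⟩)
  obtain ⟨M, ⟨⟨e₁, rfl, he₁⟩, hmax⟩⟩ := hTfin.exists_maximal ⟨_, e₀, rfl, half_le_self hε.le⟩
  have hmax' : ∀ e, ‖(c e : K)‖ ≤ ‖(c e₁ : K)‖ := fun e => by
    by_contra! h
    exact absurd (hmax ⟨e, rfl, he₁.trans h.le⟩ h.le) (not_le.mpr h)
  -- The inserted default keeps `M'` positive when no norm in `T` is smaller than the largest, and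
  -- covers all norms below the threshold.
  have hT2 : (insert (‖(c e₀ : K)‖ / 2) {r ∈ T | r < ‖(c e₁ : K)‖}).Finite :=
    (hTfin.subset (Set.sep_subset _ _)).insert _
  obtain ⟨M', hM', hmax2⟩ := hT2.exists_maximal (Set.insert_nonempty _ _)
  have hge : ∀ r ∈ insert (‖(c e₀ : K)‖ / 2) {r ∈ T | r < ‖(c e₁ : K)‖}, r ≤ M' := fun r hr => by
    by_contra! h
    exact absurd (hmax2 hr h.le) (not_le.mpr h)
  refine ⟨_, M', ?_, ?_, ⟨e₁, rfl⟩, fun e => ?_⟩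
  · exact (half_pos hε).trans_le (hge _ (Set.mem_insert _ _))
  · rcases hM' with rfl | h
    · exact (half_lt_self hε).trans_le (hmax' e₀)
    · exact h.2
  · rcases (hmax' e).eq_or_lt with h | h
    · exact Or.inl h
    · right
      by_cases h2 : ‖(c e₀ : K)‖ / 2 ≤ ‖(c e : K)‖
      · exact hge _ (Set.mem_insert_of_mem _ ⟨⟨e, rfl, h2⟩, h⟩)
      · exact (not_le.mp h2).le.trans (hge _ (Set.mem_insert _ _))

variable [CompleteSpace K]

theorem hasSum_two_variables (hA : ∀ x ∈ A, ‖x‖ ≤ 1) (F : MvPowerSeries (Fin 2) A) {z : Fin 2 → K}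
    (hz : ∀ i, ‖z i‖ < 1) :
    HasSum (fun e : Fin 2 →₀ ℕ => ((coeff e F : A) : K) * (z 0 ^ e 0 * z 1 ^ e 1))
      (evalPowerSeries A.subtype F z) := by
  simpa [Fin.prod_univ_two] using
    hasSum_evalPowerSeries (φ := A.subtype) (fun a => hA _ a.2) hz F

theorem ext_fin_two {e e' : Fin 2 →₀ ℕ} (h0 : e 0 = e' 0) (h1 : e 1 = e' 1) : e = e' := by
  ext i
  fin_cases i
  · exact h0
  · exact h1

/-- A nonzero power series in two variables over a compact ring does not vanish at points `(x, y)`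
whose coordinates have norms close to one, the first one at a higher order than the second one. -/
theorem exists_ne_zero_of_norm_near_one (hA : ∀ x ∈ A, ‖x‖ ≤ 1) (hc : IsCompact (A : Set K))
    (F : MvPowerSeries (Fin 2) A) (hF : F ≠ 0) :
    ∃ (M M' : ℝ) (l d : ℕ), 0 < M' ∧ M' < M ∧ ∀ z : Fin 2 → K, (∀ i, ‖z i‖ < 1) →
      M' < M * (‖z 0‖ ^ l * ‖z 1‖ ^ d) → ‖z 1‖ < ‖z 0‖ ^ l → evalPowerSeries A.subtype F z ≠ 0 := by
  classical
  obtain ⟨e₀, he₀⟩ := (MvPowerSeries.ne_zero_iff_exists_coeff_ne_zero F).mp hF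
  obtain ⟨M, M', hM', hMM', hatt, hgap⟩ := exists_norm_gap hc (fun e => coeff e F) ⟨e₀, he₀⟩
  -- The dominant monomial is `x ^ l * y ^ d`: among the coefficients of largest norm, `d` is the
  -- least exponent of `y`, and `l` is the least exponent of `x` in that row.
  have hd : ∃ d, ∃ e : Fin 2 →₀ ℕ, ‖((coeff e F : A) : K)‖ = M ∧ e 1 = d := by
    obtain ⟨e, he⟩ := hatt
    exact ⟨_, e, he, rfl⟩
  have hl : ∃ l, ∃ e : Fin 2 →₀ ℕ, ‖((coeff e F : A) : K)‖ = M ∧ e 1 = Nat.find hd ∧ e 0 = l := by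
    obtain ⟨e, he, h1⟩ := Nat.find_spec hd
    exact ⟨_, e, he, h1, rfl⟩
  obtain ⟨e₁, he₁, h1, h0⟩ := Nat.find_spec hl
  refine ⟨M, M', Nat.find hl, Nat.find hd, hM', hMM', fun z hz hlt hyx => ?_⟩
  have hMpos : 0 < M := hM'.trans hMM'
  set l := Nat.find hl
  set d := Nat.find hd
  have hdom : 0 < ‖z 0‖ ^ l * ‖z 1‖ ^ d := by
    by_contra! h
    have := mul_nonpos_of_nonneg_of_nonpos hMpos.le h
    linarith
  have hxd : 0 < ‖z 0‖ ^ l := (norm_nonneg _).trans_lt hyx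
  have hyd : 0 < ‖z 1‖ ^ d := (pos_iff_pos_of_mul_pos hdom).mp hxd
  have hle1 : ∀ i n, ‖z i‖ ^ n ≤ 1 := fun i n => pow_le_one₀ (norm_nonneg _) (hz i).le
  -- The competitors are coefficients of norm at most `M'`, maximal ones with larger `y`-exponent
  -- (beaten because `‖y‖ < ‖x‖ ^ l`), and maximal ones further along row `d`.
  refine hasSum_ne_zero_of_dominant (hasSum_two_variables hA F hz)
    (C := max M' (max (M * ‖z 1‖ ^ (d + 1)) (M * (‖z 0‖ ^ (l + 1) * ‖z 1‖ ^ d))))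
    (hM'.le.trans (le_max_left _ _)) e₁ ?_ fun e he => ?_
  · rw [norm_mul, norm_mul, norm_pow, norm_pow, he₁, h1, h0]
    refine max_lt hlt (max_lt ?_ ?_)
    · rw [pow_succ']
      gcongr
    · rw [pow_succ']
      have : ‖z 0‖ * ‖z 0‖ ^ l < ‖z 0‖ ^ l := mul_lt_of_lt_one_left hxd (hz 0)
      gcongr
  · rw [norm_mul, norm_mul, norm_pow, norm_pow]
    rcases hgap e with h | h
    · rw [h]
      have hde : d ≤ e 1 := Nat.find_min' hd ⟨e, h, rfl⟩
      rcases hde.eq_or_lt with h2 | h2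
      · have hle : l ≤ e 0 := Nat.find_min' hl ⟨e, h, h2.symm, rfl⟩
        have hlt' : l + 1 ≤ e 0 := by
          rcases hle.eq_or_lt with h3 | h3
          · exact absurd (ext_fin_two (h3.symm.trans h0.symm) (h2.symm.trans h1.symm)) he
          · exact h3
        refine le_trans ?_ ((le_max_right _ _).trans (le_max_right _ _))
        rw [← h2]
        gcongr M * (?_ * _)
        exact pow_le_pow_of_le_one (norm_nonneg _) (hz 0).le hlt'
      · refine le_trans ?_ ((le_max_left _ _).trans (le_max_right _ _))
        gcongr
        calc _ ≤ 1 * ‖z 1‖ ^ (d + 1) :=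
              mul_le_mul (hle1 _ _) (pow_le_pow_of_le_one (norm_nonneg _) (hz 1).le h2)
                (by positivity) zero_le_one
          _ = _ := one_mul _
    · refine le_trans ?_ (le_max_left _ _)
      calc _ ≤ M' * (1 * 1) :=
            mul_le_mul h (mul_le_mul (hle1 _ _) (hle1 _ _) (by positivity) zero_le_one)
              (by positivity) hM'.le
        _ = M' := by ring

/-- A nonzero power series in two variables over a compact ring does not vanish at points `(x, y)`
with `‖x‖` close to one and `y` close but not equal to zero, and not at `(x, 0)` either unless it
vanishes identically along `y = 0`. -/
theorem exists_ne_zero_of_near_axis (hA : ∀ x ∈ A, ‖x‖ ≤ 1) (hc : IsCompact (A : Set K))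
    (F : MvPowerSeries (Fin 2) A) (hF : F ≠ 0) :
    ∃ (M M' : ℝ) (l r : ℕ), 0 < M' ∧ M' < M ∧
      (r = 0 ∨ ∀ x, ‖x‖ < 1 → evalPowerSeries A.subtype F ![x, 0] = 0) ∧
      ∀ z : Fin 2 → K, (∀ i, ‖z i‖ < 1) → M' < M * ‖z 0‖ ^ l → ‖z 1‖ < M * ‖z 0‖ ^ l →
        (z 1 ≠ 0 ∨ r = 0) → evalPowerSeries A.subtype F z ≠ 0 := by
  classical
  -- Here `y ^ r` is the exact power of `y` dividing `F`. Row `r` dominates for small `y`, and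
  -- within it the first coefficient of largest norm dominates for `‖x‖` near one.
  have hr : ∃ r, ∃ e : Fin 2 →₀ ℕ, coeff e F ≠ 0 ∧ e 1 = r := by
    obtain ⟨e, he⟩ := (MvPowerSeries.ne_zero_iff_exists_coeff_ne_zero F).mp hF
    exact ⟨_, e, he, rfl⟩
  set r := Nat.find hr with hr_def
  have hrlt : ∀ e : Fin 2 →₀ ℕ, e 1 < r → coeff e F = 0 := fun e he => by
    by_contra h
    exact absurd (Nat.find_min' hr ⟨e, h, rfl⟩) (not_le.mpr he)
  let ex : ℕ → Fin 2 →₀ ℕ := fun i => Finsupp.equivFunOnFinite.symm ![i, r]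
  obtain ⟨M, M', hM', hMM', hatt, hgap⟩ := exists_norm_gap hc (fun i => coeff (ex i) F) (by
    obtain ⟨e, he, he1⟩ := Nat.find_spec hr
    refine ⟨e 0, ?_⟩
    have : ex (e 0) = e := ext_fin_two (by simp [ex]) (by simpa [ex] using he1.symm)
    rwa [this])
  set l := Nat.find hatt with hl_def
  have hl : ‖((coeff (ex l) F : A) : K)‖ = M := Nat.find_spec hatt
  have hMpos : 0 < M := hM'.trans hMM'
  have hFle : ∀ e, ‖((coeff e F : A) : K)‖ ≤ 1 := fun e => hA _ (coeff e F).2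
  refine ⟨M, M', l, r, hM', hMM', ?_, fun z hz h1 h2 h3 => ?_⟩
  · rcases Nat.eq_zero_or_pos r with h | h
    · exact Or.inl h
    · right
      intro x hx
      rw [evalPowerSeries]
      convert tsum_zero with e
      rw [Fin.prod_univ_two]
      rcases Nat.eq_zero_or_pos (e 1) with h4 | h4
      · simp [hrlt e (h4 ▸ h)]
      · simp [h4.ne']
  have hyr : 0 < ‖z 1‖ ^ r := by
    rcases h3 with h3 | h3
    · exact pow_pos (norm_pos_iff.mpr h3) _
    · rw [h3]; simp
  have hxl : 0 < ‖z 0‖ ^ l := by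
    by_contra! h
    have := mul_nonpos_of_nonneg_of_nonpos hMpos.le h
    linarith
  have hle1 : ∀ i n, ‖z i‖ ^ n ≤ 1 := fun i n => pow_le_one₀ (norm_nonneg _) (hz i).le
  refine hasSum_ne_zero_of_dominant (hasSum_two_variables hA F hz)
    (C := max M' (max ‖z 1‖ (M * ‖z 0‖ ^ (l + 1))) * ‖z 1‖ ^ r)
    (mul_nonneg (hM'.le.trans (le_max_left _ _)) hyr.le) (ex l) ?_ fun e he => ?_
  · rw [norm_mul, norm_mul, norm_pow, norm_pow, hl, ← mul_assoc]
    have e0 : ex l 0 = l := by simp [ex]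
    have e1 : ex l 1 = r := by simp [ex]
    rw [e0, e1]
    refine mul_lt_mul_of_pos_right (max_lt h1 (max_lt h2 ?_)) hyr
    rw [pow_succ']
    have : ‖z 0‖ * ‖z 0‖ ^ l < ‖z 0‖ ^ l := mul_lt_of_lt_one_left hxl (hz 0)
    gcongr
  · rw [norm_mul, norm_mul, norm_pow, norm_pow]
    rcases lt_trichotomy (e 1) r with h | h | h
    · rw [hrlt e h]
      simp only [ZeroMemClass.coe_zero, norm_zero, zero_mul]
      exact mul_nonneg (hM'.le.trans (le_max_left _ _)) hyr.le
    · have hee : e = ex (e 0) := ext_fin_two (by simp [ex]) (by simpa [ex] using h)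
      rw [h, ← mul_assoc]
      refine mul_le_mul_of_nonneg_right ?_ hyr.le
      rcases hgap (e 0) with h4 | h4
      · rw [hee, h4]
        have h5 : l ≤ e 0 := Nat.find_min' hatt h4
        have h6 : l + 1 ≤ e 0 := by
          rcases h5.eq_or_lt with h6 | h6
          · exact absurd (hee.trans (by rw [← h6])) he
          · exact h6
        refine le_trans ?_ ((le_max_right _ _).trans (le_max_right _ _))
        gcongr M * ?_
        have : ex (e 0) 0 = e 0 := by simp [ex]
        rw [this]
        exact pow_le_pow_of_le_one (norm_nonneg _) (hz 0).le h6
      · rw [← hee] at h4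
        refine le_trans ?_ (le_max_left _ _)
        calc _ ≤ M' * 1 := by
              gcongr
              exact hle1 _ _
          _ = M' := mul_one _
    · calc _ ≤ 1 * (1 * ‖z 1‖ ^ (r + 1)) :=
            mul_le_mul (hFle _) (mul_le_mul (hle1 _ _)
              (pow_le_pow_of_le_one (norm_nonneg _) (hz 1).le h) (by positivity) zero_le_one)
              (by positivity) zero_le_one
        _ = ‖z 1‖ * ‖z 1‖ ^ r := by rw [one_mul, one_mul, pow_succ']
        _ ≤ _ := by
          gcongr
          exact (le_max_left _ _).trans (le_max_right _ _)

/-- The zeros of a nonzero power series in one variable do not accumulate at zero. -/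
theorem exists_ne_zero_of_near_zero (hA : ∀ x ∈ A, ‖x‖ ≤ 1)
    (F : MvPowerSeries (Fin 1) A) (hF : F ≠ 0) :
    ∃ ε : ℝ, 0 < ε ∧ ∀ z : Fin 1 → K, (∀ i, ‖z i‖ < 1) → z 0 ≠ 0 → ‖z 0‖ < ε →
      evalPowerSeries A.subtype F z ≠ 0 := by
  classical
  have hr : ∃ r, ∃ e : Fin 1 →₀ ℕ, coeff e F ≠ 0 ∧ e 0 = r := by
    obtain ⟨e, he⟩ := (MvPowerSeries.ne_zero_iff_exists_coeff_ne_zero F).mp hF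
    exact ⟨_, e, he, rfl⟩
  obtain ⟨e₁, he₁, h1⟩ := Nat.find_spec hr
  set r := Nat.find hr
  -- The radius is the norm of the lowest nonzero coefficient: all later coefficients have norm at
  -- most one and carry an extra factor of `z`.
  refine ⟨‖((coeff e₁ F : A) : K)‖, by simpa using he₁, fun z hz h0 hε => ?_⟩
  have hzr : 0 < ‖z 0‖ ^ r := pow_pos (norm_pos_iff.mpr h0) _
  have hs := hasSum_evalPowerSeries (φ := A.subtype) (fun a => hA _ a.2) hz F
  refine hasSum_ne_zero_of_dominant hs (C := ‖z 0‖ ^ (r + 1)) (by positivity) e₁ ?_ fun e he => ?_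
  · simp only [Fin.prod_univ_one, norm_mul, norm_pow, h1]
    rw [pow_succ']
    exact mul_lt_mul_of_pos_right hε hzr
  · simp only [Fin.prod_univ_one, norm_mul, norm_pow]
    rcases lt_or_ge (e 0) (r + 1) with h | h
    · have h2 : coeff e F = 0 := by
        by_contra h2
        have h3 : r ≤ e 0 := Nat.find_min' hr ⟨e, h2, rfl⟩
        refine he (Finsupp.ext fun i => ?_)
        rw [Fin.fin_one_eq_zero i, h1]
        omega
      rw [h2]
      simp
    · calc _ ≤ 1 * ‖z 0‖ ^ (r + 1) := by
            gcongr ?_ * ?_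
            · exact hA _ (coeff e F).2
            · exact pow_le_pow_of_le_one (norm_nonneg _) (hz 0).le h
        _ = _ := one_mul _

end Dominance

/-! ### Distances of `p`-power roots of unity from one. -/

section RootsOfUnity

open Filter Topology

variable {p : ℕ} [hp : Fact p.Prime]

theorem IsPPowerRootOfUnity.exists_isPrimitiveRoot {ζ : ℂ_[p]} (h : IsPPowerRootOfUnity p ζ) :
    ∃ n, IsPrimitiveRoot ζ (p ^ n) := by
  obtain ⟨n, hn⟩ := h
  obtain ⟨m, -, hm⟩ := (Nat.dvd_prime_pow hp.out).mp (orderOf_dvd_of_pow_eq_one hn)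
  exact ⟨m, hm ▸ IsPrimitiveRoot.orderOf ζ⟩

theorem IsPPowerRootOfUnity.norm_eq_one {ζ : ℂ_[p]} (h : IsPPowerRootOfUnity p ζ) : ‖ζ‖ = 1 := by
  obtain ⟨n, hn⟩ := h
  have h1 := congrArg norm hn
  rw [norm_pow, norm_one] at h1
  exact (pow_eq_one_iff_of_nonneg (norm_nonneg _) (pow_pos hp.out.pos n).ne').mp h1

theorem norm_pow_sub_one_le {ζ : ℂ_[p]} (h : ‖ζ‖ ≤ 1) (i : ℕ) : ‖ζ ^ i - 1‖ ≤ ‖ζ - 1‖ := by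
  rw [← geom_sum_mul, norm_mul]
  refine mul_le_of_le_one_left (norm_nonneg _)
    (IsUltrametricDist.norm_sum_le_of_forall_le_of_nonneg zero_le_one fun k _ => ?_)
  rw [norm_pow]
  exact pow_le_one₀ (norm_nonneg _) h

/-- The cyclotomic polynomial takes the value `p` at one, which is the product of all `1 - μ`. The
factors have equal norm, since primitive roots of the same order are powers of each other. -/
theorem IsPrimitiveRoot.norm_sub_one_pow_totient {ζ : ℂ_[p]} {n : ℕ}
    (h : IsPrimitiveRoot ζ (p ^ (n + 1))) :
    ‖ζ - 1‖ ^ (p ^ (n + 1)).totient = (p : ℝ)⁻¹ := by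
  have hpos : 0 < p ^ (n + 1) := pow_pos hp.out.pos _
  have h1 : ∀ μ ∈ primitiveRoots (p ^ (n + 1)) ℂ_[p], ‖1 - μ‖ = ‖ζ - 1‖ := by
    intro μ hμ
    rw [mem_primitiveRoots hpos] at hμ
    have hle : ∀ {ζ μ : ℂ_[p]}, IsPrimitiveRoot ζ (p ^ (n + 1)) →
        IsPrimitiveRoot μ (p ^ (n + 1)) → ‖μ - 1‖ ≤ ‖ζ - 1‖ := fun {ζ μ} hζ hμ => by
      have : NeZero (p ^ (n + 1)) := ⟨hpos.ne'⟩
      obtain ⟨i, -, rfl⟩ := hζ.eq_pow_of_pow_eq_one hμ.pow_eq_one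
      exact norm_pow_sub_one_le (IsPPowerRootOfUnity.norm_eq_one ⟨_, hζ.pow_eq_one⟩).le i
    rw [norm_sub_rev]
    exact le_antisymm (hle h hμ) (hle hμ h)
  have h2 := Polynomial.eval_one_cyclotomic_prime_pow (R := ℂ_[p]) (p := p) n
  rw [Polynomial.cyclotomic_eq_prod_X_sub_primitiveRoots h, Polynomial.eval_prod] at h2
  have h3 := congrArg norm h2
  simp only [Polynomial.eval_sub, Polynomial.eval_X, Polynomial.eval_C, norm_prod] at h3
  rw [Finset.prod_congr rfl h1, Finset.prod_const, h.card_primitiveRoots] at h3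
  rw [h3]
  have h4 := norm_padicIntHom p (p : ℤ_[p])
  rwa [map_natCast, PadicInt.norm_p] at h4

theorem inv_prime_lt_one : (p : ℝ)⁻¹ < 1 := inv_lt_one_of_one_lt₀ (by exact_mod_cast hp.out.one_lt)

theorem inv_prime_pos : 0 < (p : ℝ)⁻¹ := inv_pos.mpr (by exact_mod_cast hp.out.pos)

theorem IsPPowerRootOfUnity.norm_sub_one_lt {ζ : ℂ_[p]} (h : IsPPowerRootOfUnity p ζ) :
    ‖ζ - 1‖ < 1 := by
  obtain ⟨n, hn⟩ := h.exists_isPrimitiveRoot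
  rcases n with _ | n
  · rw [pow_zero, IsPrimitiveRoot.one_right_iff] at hn
    simp [hn]
  · by_contra! h1
    have h2 := hn.norm_sub_one_pow_totient
    have h3 := one_le_pow₀ (n := (p ^ (n + 1)).totient) h1
    rw [h2] at h3
    exact absurd h3 (not_le.mpr inv_prime_lt_one)

theorem IsPPowerRootOfUnity.inv_prime_le_norm_sub_one_pow {ζ : ℂ_[p]}
    (h : IsPPowerRootOfUnity p ζ) (h1 : ζ ≠ 1) : (p : ℝ)⁻¹ ≤ ‖ζ - 1‖ ^ (p - 1) := by
  obtain ⟨n, hn⟩ := h.exists_isPrimitiveRoot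
  rcases n with _ | n
  · rw [pow_zero, IsPrimitiveRoot.one_right_iff] at hn
    exact absurd hn h1
  · rw [← hn.norm_sub_one_pow_totient]
    refine pow_le_pow_of_le_one (norm_nonneg _) h.norm_sub_one_lt.le ?_
    rw [Nat.totient_prime_pow_succ hp.out]
    exact Nat.le_mul_of_pos_left _ (pow_pos hp.out.pos n)

/-- For order at least `p ^ 2` equality holds, as the totient drops by the factor `p`; for smaller
order the left side is zero. -/
theorem IsPPowerRootOfUnity.norm_pow_prime_sub_one_le {ζ : ℂ_[p]} (h : IsPPowerRootOfUnity p ζ) :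
    ‖ζ ^ p - 1‖ ≤ ‖ζ - 1‖ ^ p := by
  obtain ⟨n, hn⟩ := h.exists_isPrimitiveRoot
  rcases n with _ | _ | n
  · rw [pow_zero, IsPrimitiveRoot.one_right_iff] at hn
    simp [hn, hp.out.ne_zero]
  · rw [zero_add, pow_one] at hn
    rw [hn.pow_eq_one, sub_self, norm_zero]
    positivity
  · have h1 : IsPrimitiveRoot (ζ ^ p) (p ^ (n + 1)) :=
      hn.pow (pow_pos hp.out.pos _) (by rw [pow_succ' p (n + 1)])
    have h2 := hn.norm_sub_one_pow_totient.trans h1.norm_sub_one_pow_totient.symm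
    rw [pow_succ' p (n + 1), Nat.totient_mul_of_prime_of_dvd hp.out
      (dvd_pow_self p (Nat.succ_ne_zero n)), pow_mul] at h2
    exact le_of_eq ((pow_left_inj₀ (norm_nonneg _) (by positivity)
      (Nat.totient_pos.mpr (pow_pos hp.out.pos _)).ne').mp h2.symm)

theorem IsPPowerRootOfUnity.pow {ζ : ℂ_[p]} (h : IsPPowerRootOfUnity p ζ) (k : ℕ) :
    IsPPowerRootOfUnity p (ζ ^ k) := by
  obtain ⟨n, hn⟩ := h
  exact ⟨n, by rw [← pow_mul, mul_comm, pow_mul, hn, one_pow]⟩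

theorem IsPPowerRootOfUnity.norm_pow_prime_pow_sub_one_le {ζ : ℂ_[p]}
    (h : IsPPowerRootOfUnity p ζ) (m : ℕ) : ‖ζ ^ p ^ m - 1‖ ≤ ‖ζ - 1‖ ^ p ^ m := by
  induction m with
  | zero => simp
  | succ m ih =>
    rw [pow_succ, pow_mul, pow_mul]
    exact (h.pow _).norm_pow_prime_sub_one_le.trans (pow_le_pow_left₀ (norm_nonneg _) ih p)

theorem IsPPowerRootOfUnity.oneUnitPow {ζ : ℂ_[p]} (h : IsPPowerRootOfUnity p ζ) (j : ℤ_[p]) :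
    IsPPowerRootOfUnity p (oneUnitPow ζ j) := by
  obtain ⟨n, hn⟩ := h
  exact ⟨n, by rw [oneUnitPow_pow (norm_sub_one_lt ⟨n, hn⟩), hn, one_oneUnitPow]⟩

/-- The totient-th power of `‖ζ - 1‖` is always `1 / p`, while the totient grows with the order, so
the norm itself approaches one. -/
theorem exists_lt_norm_sub_one {ρ : ℝ} (hρ : ρ < 1) :
    ∃ N : ℕ, ∀ ζ : ℂ_[p], IsPPowerRootOfUnity p ζ → ζ ^ p ^ N ≠ 1 → ρ < ‖ζ - 1‖ := by
  rcases lt_or_ge ρ 0 with h0 | h0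
  · exact ⟨0, fun ζ _ _ => h0.trans_le (norm_nonneg _)⟩
  obtain ⟨N, hN⟩ := exists_pow_lt_of_lt_one (inv_prime_pos (p := p)) hρ
  refine ⟨N, fun ζ hζ hζN => ?_⟩
  by_contra! hle
  obtain ⟨n, hn⟩ := hζ.exists_isPrimitiveRoot
  have hNn : N < n := by
    by_contra! h
    exact hζN ((hn.pow_eq_one_iff_dvd _).mpr (pow_dvd_pow p h))
  obtain ⟨m, rfl⟩ : ∃ m, n = m + 1 := ⟨n - 1, by omega⟩
  have h1 := hn.norm_sub_one_pow_totient
  have h2 : N ≤ (p ^ (m + 1)).totient := by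
    rw [Nat.totient_prime_pow_succ hp.out]
    have h3 : m < p ^ m := Nat.lt_pow_self hp.out.one_lt
    have h4 : p ^ m ≤ p ^ m * (p - 1) :=
      Nat.le_mul_of_pos_right _ (Nat.sub_pos_of_lt hp.out.one_lt)
    omega
  have h3 : ‖ζ - 1‖ ^ (p ^ (m + 1)).totient ≤ ρ ^ N :=
    (pow_le_pow_left₀ (norm_nonneg _) hle _).trans (pow_le_pow_of_le_one h0 hρ.le h2)
  linarith

theorem finite_setOf_pow_eq_one (N : ℕ) : {ζ : ℂ_[p] | ζ ^ p ^ N = 1}.Finite := by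
  have hpos : 0 < p ^ N := pow_pos hp.out.pos N
  refine (Polynomial.nthRootsFinset (p ^ N) (1 : ℂ_[p])).finite_toSet.subset fun ζ hζ => ?_
  rw [Finset.mem_coe, Polynomial.mem_nthRootsFinset hpos]
  exact hζ

theorem infinite_setOf_isPPowerRootOfUnity : {ζ : ℂ_[p] | IsPPowerRootOfUnity p ζ}.Infinite := by
  have h : ∀ n : ℕ, ∃ ζ : ℂ_[p], IsPrimitiveRoot ζ (p ^ n) := fun n => by
    have : NeZero ((p ^ n : ℕ) : ℂ_[p]) := ⟨by exact_mod_cast (pow_pos hp.out.pos n).ne'⟩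
    exact HasEnoughRootsOfUnity.exists_primitiveRoot _ _
  choose ζ hζ using h
  refine Set.infinite_of_injective_forall_mem (f := ζ) (fun m n hmn => ?_)
    fun n => ⟨n, (hζ n).pow_eq_one⟩
  have h1 := hζ n
  rw [← hmn] at h1
  exact Nat.pow_right_injective hp.out.two_le ((hζ m).unique h1)

/-- Of two roots of unity of `p`-power order one is a power of the other. -/
theorem exists_eq_pow_or_eq_pow {ζ ξ : ℂ_[p]} (hζ : IsPPowerRootOfUnity p ζ)
    (hξ : IsPPowerRootOfUnity p ξ) : (∃ c : ℕ, ξ = ζ ^ c) ∨ ∃ c : ℕ, ζ = ξ ^ c := by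
  obtain ⟨m, hm⟩ := hζ.exists_isPrimitiveRoot
  obtain ⟨n, hn⟩ := hξ.exists_isPrimitiveRoot
  have aux : ∀ {ζ ξ : ℂ_[p]} {m n : ℕ}, IsPrimitiveRoot ζ (p ^ m) → IsPrimitiveRoot ξ (p ^ n) →
      n ≤ m → ∃ c : ℕ, ξ = ζ ^ c := fun {ζ ξ m n} hm hn hnm => by
    have : NeZero (p ^ m) := ⟨(pow_pos hp.out.pos m).ne'⟩
    obtain ⟨c, -, hc⟩ := hm.eq_pow_of_pow_eq_one
      ((hn.pow_eq_one_iff_dvd _).mpr (pow_dvd_pow p hnm))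
    exact ⟨c, hc.symm⟩
  rcases le_total n m with h | h
  · exact Or.inl (aux hm hn h)
  · exact Or.inr (aux hn hm h)

end RootsOfUnity

/-! ### The group `1 + q ℤ_p` compared with roots of unity. -/

section TopologicalGenerator

variable {p : ℕ} [hp : Fact p.Prime]

theorem norm_sub_one_le_of_dvd {u : ℤ_[p]} (h : ((if p = 2 then 4 else p : ℕ) : ℤ_[p]) ∣ u - 1) :
    ‖u - 1‖ ≤ ((p : ℝ)⁻¹) ^ (if p = 2 then 2 else 1) := by
  obtain ⟨c, hc⟩ := h
  rw [hc, norm_mul]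
  refine (mul_le_of_le_one_right (norm_nonneg _) c.norm_le_one).trans_eq ?_
  split_ifs with h2
  · subst h2
    have : ((4 : ℕ) : ℤ_[2]) = ((2 : ℕ) : ℤ_[2]) ^ 2 := by norm_num
    rw [this, norm_pow, PadicInt.norm_p]
  · rw [PadicInt.norm_p, pow_one]

variable {u : ℤ_[p]} (hu : ((if p = 2 then 4 else p : ℕ) : ℤ_[p]) ∣ u - 1)

include hu

theorem norm_padicIntHom_sub_one_le :
    ‖padicIntHom p u - 1‖ ≤ ((p : ℝ)⁻¹) ^ (if p = 2 then 2 else 1) := by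
  rw [← map_one (padicIntHom p), ← map_sub, norm_padicIntHom]
  exact norm_sub_one_le_of_dvd hu

theorem norm_padicIntHom_sub_one_lt : ‖padicIntHom p u - 1‖ < 1 :=
  (norm_padicIntHom_sub_one_le hu).trans_lt
    (pow_lt_one₀ inv_prime_pos.le inv_prime_lt_one (by split_ifs <;> simp))

/-- The `(p - 1)`-st power of the left side is at most `p ^ (-2)`, that of the right side at least
`p ^ (-1)`. For `p = 2` this needs `q = 4`: the root of unity `-1` lies in `1 + 2 ℤ_2`. -/
theorem norm_padicIntHom_sub_one_lt_norm_sub_one {ζ : ℂ_[p]} (hζ : IsPPowerRootOfUnity p ζ)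
    (h1 : ζ ≠ 1) : ‖padicIntHom p u - 1‖ < ‖ζ - 1‖ := by
  by_contra! h
  have h2 := hζ.inv_prime_le_norm_sub_one_pow h1
  have h3 := h.trans (norm_padicIntHom_sub_one_le hu)
  have h4 := h2.trans (pow_le_pow_left₀ (norm_nonneg _) h3 (p - 1))
  rw [← pow_mul] at h4
  have h5 : 2 ≤ (if p = 2 then 2 else 1) * (p - 1) := by
    have := hp.out.two_le
    split_ifs with hp2
    · subst hp2; norm_num
    · omega
  have h6 := h4.trans (pow_le_pow_of_le_one inv_prime_pos.le inv_prime_lt_one.le h5)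
  rw [pow_two] at h6
  have := mul_lt_of_lt_one_left (inv_prime_pos (p := p)) (inv_prime_lt_one (p := p))
  linarith

/-- In `w ζ - 1 = (w - 1) ζ + (ζ - 1)` the second summand dominates, so the exponent `t` does not
affect the norm. -/
theorem norm_oneUnitPow_mul_sub_one {ζ : ℂ_[p]} (hζ : IsPPowerRootOfUnity p ζ)
    (h1 : ζ ≠ 1) (t : ℤ_[p]) : ‖oneUnitPow (padicIntHom p u) t * ζ - 1‖ = ‖ζ - 1‖ := by
  set w := oneUnitPow (padicIntHom p u) t
  have hw : ‖(w - 1) * ζ‖ < ‖ζ - 1‖ := by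
    rw [norm_mul, hζ.norm_eq_one, mul_one]
    exact (norm_oneUnitPow_sub_one_le (norm_padicIntHom_sub_one_lt hu) t).trans_lt
      (norm_padicIntHom_sub_one_lt_norm_sub_one hu hζ h1)
  have h := IsUltrametricDist.norm_add_eq_max_of_norm_ne_norm hw.ne
  rw [max_eq_right hw.le] at h
  rw [← h]
  congr 1
  ring

/-- Up to a unit a nonzero `a` is a power of `p`, so `u` would be a nontrivial `p`-power root of
unity and hence strictly closer to one than itself. -/
theorem oneUnitPow_padicIntHom_eq_one (hu1 : u ≠ 1) {a : ℤ_[p]}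
    (ha : oneUnitPow (padicIntHom p u) a = 1) : a = 0 := by
  by_contra h0
  have hu' := norm_padicIntHom_sub_one_lt hu
  obtain ⟨b, hb⟩ : ∃ b : ℤ_[p], a * b = (p : ℤ_[p]) ^ a.valuation := by
    refine ⟨((PadicInt.unitCoeff h0)⁻¹ : ℤ_[p]ˣ), ?_⟩
    rw [← Units.eq_mul_inv_iff_mul_eq, inv_inv, mul_comm]
    exact PadicInt.unitCoeff_spec h0
  have h1 : padicIntHom p u ^ p ^ a.valuation = 1 := by
    rw [← oneUnitPow_natCast, Nat.cast_pow, ← hb, oneUnitPow_mul hu', ha, one_oneUnitPow]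
  have h2 : padicIntHom p u ≠ 1 := fun h =>
    hu1 (padicIntHom_injective p (h.trans (map_one _).symm))
  exact (norm_padicIntHom_sub_one_lt_norm_sub_one hu ⟨_, h1⟩ h2).false

theorem oneUnitPow_padicIntHom_injective (hu1 : u ≠ 1) :
    Function.Injective (oneUnitPow (padicIntHom p u)) := fun a b hab => by
  have hu' := norm_padicIntHom_sub_one_lt hu
  rw [← sub_eq_zero]
  refine oneUnitPow_padicIntHom_eq_one hu hu1 ?_
  rw [sub_eq_add_neg, oneUnitPow_add hu', oneUnitPow_neg hu', hab,
    mul_inv_cancel₀ (oneUnitPow_ne_zero hu' b)]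

omit hu

variable {γ : ℤ_[p]ˣ} (hγ : IsTopologicalGenerator p γ)

include hγ

theorem IsTopologicalGenerator.dvd_sub_one :
    ((if p = 2 then 4 else p : ℕ) : ℤ_[p]) ∣ (γ : ℤ_[p]) - 1 := by
  have h : γ ∈ closure ((Subgroup.zpowers γ : Subgroup ℤ_[p]ˣ) : Set ℤ_[p]ˣ) :=
    subset_closure (Subgroup.mem_zpowers γ)
  rw [hγ] at h
  exact h

/-- Every element of `1 + q ℤ_p` is a power of a topological generator. -/
theorem IsTopologicalGenerator.exists_eq_oneUnitPow
    (hu : ((if p = 2 then 4 else p : ℕ) : ℤ_[p]) ∣ u - 1) :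
    ∃ a : ℤ_[p], padicIntHom p u = oneUnitPow (padicIntHom p γ) a := by
  have hγ1 := norm_padicIntHom_sub_one_lt hγ.dvd_sub_one
  have hunit : IsUnit u := by
    rw [PadicInt.isUnit_iff, ← norm_padicIntHom]
    exact norm_one_unit (norm_padicIntHom_sub_one_lt hu)
  obtain ⟨v, rfl⟩ := hunit
  have hv : v ∈ closure ((Subgroup.zpowers γ : Subgroup ℤ_[p]ˣ) : Set ℤ_[p]ˣ) := by
    rw [hγ]
    exact hu
  -- The set of `p`-adic powers is a compact image of `ℤ_p`, so it contains the closure of the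
  -- integral powers.
  have hclosed : IsClosed (Set.range (oneUnitPow (padicIntHom p (γ : ℤ_[p])))) :=
    (isCompact_range (continuous_oneUnitPow hγ1)).isClosed
  have hpre := hclosed.preimage ((continuous_padicIntHom p).comp Units.continuous_val)
  have hsub : ((Subgroup.zpowers γ : Subgroup ℤ_[p]ˣ) : Set ℤ_[p]ˣ) ⊆
      (padicIntHom p ∘ (Units.val : ℤ_[p]ˣ → ℤ_[p])) ⁻¹'
        Set.range (oneUnitPow (padicIntHom p (γ : ℤ_[p]))) := by
    rintro _ ⟨n, rfl⟩
    have hnat : ∀ m : ℕ, padicIntHom p ((γ ^ m : ℤ_[p]ˣ) : ℤ_[p]) =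
        oneUnitPow (padicIntHom p γ) m := fun m => by
      rw [oneUnitPow_natCast, Units.val_pow_eq_pow_val, map_pow]
    rcases n.eq_nat_or_neg with ⟨m, rfl | rfl⟩
    · exact ⟨m, by simpa using (hnat m).symm⟩
    · refine ⟨-m, ?_⟩
      rw [oneUnitPow_neg hγ1, ← hnat]
      refine inv_eq_of_mul_eq_one_left ?_
      rw [Function.comp_apply, ← map_mul, ← Units.val_mul]
      simp
  obtain ⟨a, ha⟩ := closure_minimal hsub hpre hv
  exact ⟨a, ha.symm⟩

theorem IsTopologicalGenerator.ne_one : (γ : ℤ_[p]) ≠ 1 := by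
  intro h
  obtain ⟨a, ha⟩ := hγ.exists_eq_oneUnitPow
    (u := 1 + ((if p = 2 then 4 else p : ℕ) : ℤ_[p])) (by rw [add_sub_cancel_left])
  rw [h, map_one, one_oneUnitPow, ← map_one (padicIntHom p)] at ha
  have := padicIntHom_injective p ha
  rw [add_eq_left, Nat.cast_eq_zero] at this
  split_ifs at this
  exact hp.out.ne_zero this

end TopologicalGenerator

/-! ### Compact coefficient rings and pullbacks along multiplicative charts. -/

section Charts

open MvPowerSeries Filter Topology

variable (p : ℕ) [hp : Fact p.Prime]

/-- The ring `ℤ_p[μ_{p^N}]` inside `ℂ_[p]`. -/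
noncomputable def cyclotomicIntegers (N : ℕ) : Subring ℂ_[p] :=
  (MonoidAlgebra.liftNCRingHom (padicIntHom p)
    ((Units.coeHom ℂ_[p]).comp (rootsOfUnity (p ^ N) ℂ_[p]).subtype)
    fun _ _ => Commute.all _ _).range

/-- The group of `p ^ N`-th roots of unity is finite, so the ring is a continuous image of a finite
power of `ℤ_p`. -/
theorem isCompact_cyclotomicIntegers (N : ℕ) : IsCompact (cyclotomicIntegers p N : Set ℂ_[p]) := by
  classical
  have : NeZero (p ^ N) := ⟨(pow_pos hp.out.pos N).ne'⟩
  let G : Type := rootsOfUnity (p ^ N) ℂ_[p]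
  have : Fintype G := Fintype.ofFinite (rootsOfUnity (p ^ N) ℂ_[p])
  let T : (G → ℤ_[p]) →+ ℂ_[p] :=
    { toFun := fun c => ∑ g : G, padicIntHom p (c g) * ((g : ℂ_[p]ˣ) : ℂ_[p])
      map_zero' := by simp
      map_add' := fun c d => by simp [add_mul, Finset.sum_add_distrib] }
  have hT : Continuous T := by
    have := continuous_padicIntHom p
    change Continuous fun c : G → ℤ_[p] =>
      ∑ g : G, padicIntHom p (c g) * ((g : ℂ_[p]ˣ) : ℂ_[p])
    fun_prop
  convert isCompact_range hT using 1
  refine Set.Subset.antisymm ?_ ?_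
  · rintro _ ⟨x, rfl⟩
    induction x using MonoidAlgebra.induction_linear with
    | zero => exact ⟨0, by simp⟩
    | add x y hx hy =>
      obtain ⟨c, hc⟩ := hx
      obtain ⟨d, hd⟩ := hy
      exact ⟨c + d, by rw [map_add, hc, hd, map_add]⟩
    | single g r =>
      refine ⟨Pi.single g r, ?_⟩
      change ∑ g' : G, padicIntHom p ((Pi.single g r : G → ℤ_[p]) g') * _ = _
      rw [Finset.sum_eq_single g]
      · simp [MonoidAlgebra.liftNCRingHom]
      · intro b _ hb
        simp [Pi.single_eq_of_ne hb]
      · simp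
  · rintro _ ⟨c, rfl⟩
    change ∑ g : G, padicIntHom p (c g) * ((g : ℂ_[p]ˣ) : ℂ_[p]) ∈ cyclotomicIntegers p N
    refine sum_mem fun g _ => ⟨MonoidAlgebra.single g (c g), ?_⟩
    simp [MonoidAlgebra.liftNCRingHom]

variable {p}

theorem padicIntHom_mem_cyclotomicIntegers (N : ℕ) (a : ℤ_[p]) :
    padicIntHom p a ∈ cyclotomicIntegers p N :=
  ⟨MonoidAlgebra.single 1 a, by simp [MonoidAlgebra.liftNCRingHom]⟩

theorem mem_cyclotomicIntegers {N : ℕ} {ζ : ℂ_[p]} (h : ζ ^ p ^ N = 1) :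
    ζ ∈ cyclotomicIntegers p N := by
  have : NeZero (p ^ N) := ⟨(pow_pos hp.out.pos N).ne'⟩
  exact ⟨MonoidAlgebra.single (rootsOfUnity.mkOfPowEq ζ h) 1,
    by simp [MonoidAlgebra.liftNCRingHom]⟩

theorem norm_le_one_of_mem_cyclotomicIntegers {N : ℕ} :
    ∀ x ∈ cyclotomicIntegers p N, ‖x‖ ≤ 1 := by
  have : cyclotomicIntegers p N ≤ closedUnitBallSubring ℂ_[p] := by
    rintro _ ⟨x, rfl⟩
    induction x using MonoidAlgebra.induction_linear with
    | zero => rw [map_zero]; exact zero_mem _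
    | add x y hx hy => rw [map_add]; exact add_mem hx hy
    | single g r =>
      have h1 : ‖((g : ℂ_[p]ˣ) : ℂ_[p])‖ = 1 := IsPPowerRootOfUnity.norm_eq_one (p := p)
        ⟨N, by simpa using congrArg Units.val ((mem_rootsOfUnity _ _).mp g.2)⟩
      change ‖_‖ ≤ 1
      simpa [MonoidAlgebra.liftNCRingHom, h1] using norm_padicIntHom_le_one p r
  exact this

theorem oneUnitPow_mem_cyclotomicIntegers {N : ℕ} {u : ℂ_[p]} (hu : ‖u - 1‖ < 1)
    (h : u ∈ cyclotomicIntegers p N) (j : ℤ_[p]) : oneUnitPow u j ∈ cyclotomicIntegers p N :=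
  PadicInt.denseRange_natCast.induction_on (p := fun j => oneUnitPow u j ∈ cyclotomicIntegers p N) j
    ((isCompact_cyclotomicIntegers p N).isClosed.preimage (continuous_oneUnitPow hu)) fun n => by
      rw [oneUnitPow_natCast]
      exact pow_mem h n

/-- The structure map `ℤ_p → ℤ_p[μ_{p^N}]`. -/
noncomputable def padicIntToCyclotomicIntegers (N : ℕ) : ℤ_[p] →+* cyclotomicIntegers p N :=
  (padicIntHom p).codRestrict _ (padicIntHom_mem_cyclotomicIntegers N)

theorem evalPowerSeries_zero {R K σ : Type*} [CommRing R] [Fintype σ] [NormedField K] (φ : R →+* K)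
    (f : MvPowerSeries σ R) :
    evalPowerSeries φ f (fun _ => 0) = φ (constantCoeff f) := by
  rw [evalPowerSeries, tsum_eq_single 0]
  · simp
  · intro e he
    obtain ⟨i, hi⟩ := Finsupp.ne_iff.mp he
    rw [Finset.prod_eq_zero (Finset.mem_univ i) (zero_pow hi), mul_zero]

/-- The pullback of a power series along a parametrization of the torus by one-units is again given
by a power series. -/
theorem exists_pullback_series {τ : Type*} [Fintype τ] (N : ℕ)
    (L : MvPowerSeries (Fin 2) ℤ_[p]) (c : Fin 2 → ℂ_[p]) (hcA : ∀ i, c i ∈ cyclotomicIntegers p N)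
    (hc : ∀ i, ‖c i - 1‖ < 1) (v : Fin 2 → τ → ℤ_[p]) :
    ∃ F : MvPowerSeries τ (cyclotomicIntegers p N), ∀ z : τ → ℂ_[p], (∀ i, ‖z i‖ < 1) →
      evalPowerSeries (cyclotomicIntegers p N).subtype F z =
        evalPowerSeries (padicIntHom p) L
          (fun i => c i * ∏ t, oneUnitPow (1 + z t) (v i t) - 1) := by
  have hA := norm_le_one_of_mem_cyclotomicIntegers (p := p) (N := N)
  have hφ : ∀ r, ‖(cyclotomicIntegers p N).subtype r‖ ≤ 1 := fun r => hA _ r.2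
  have hcl := (isCompact_cyclotomicIntegers p N).isClosed
  have hθ : Continuous (padicIntToCyclotomicIntegers (p := p) N) :=
    (continuous_padicIntHom p).subtype_mk _
  have hcomp : (cyclotomicIntegers p N).subtype.comp (padicIntToCyclotomicIntegers N) =
      padicIntHom p := rfl
  have hB : ∀ (j : ℤ_[p]) (t : τ), ∃ G : MvPowerSeries τ (cyclotomicIntegers p N),
      ∀ z : τ → ℂ_[p], (∀ i, ‖z i‖ < 1) →
        evalPowerSeries (cyclotomicIntegers p N).subtype G z = oneUnitPow (1 + z t) j := by
    intro j t
    obtain ⟨G, hG⟩ := exists_evalPowerSeries_comp hA hcl (padicIntToCyclotomicIntegers N) hθ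
      (binomialPowerSeries j)
      (fun _ => (X t : MvPowerSeries τ (cyclotomicIntegers p N))) (fun _ => by simp)
    refine ⟨G, fun z hz => ?_⟩
    rw [hG z hz, hcomp, evalPowerSeries_binomialPowerSeries, evalPowerSeries_X hφ hz]
  choose B hB using hB
  let a : Fin 2 → MvPowerSeries τ (cyclotomicIntegers p N) := fun i =>
    C (⟨c i, hcA i⟩ : cyclotomicIntegers p N) * ∏ t, B (v i t) t - 1
  have ha : ∀ i, ∀ z : τ → ℂ_[p], (∀ i, ‖z i‖ < 1) →
      evalPowerSeries (cyclotomicIntegers p N).subtype (a i) z =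
        c i * ∏ t, oneUnitPow (1 + z t) (v i t) - 1 := by
    intro i z hz
    rw [evalPowerSeries_sub hφ hz, evalPowerSeries_mul hφ hz, evalPowerSeries_C hφ hz,
      evalPowerSeries_one hφ hz, ← coe_evalPowerSeriesHom hφ hz (∏ t, B (v i t) t), map_prod]
    simp only [coe_evalPowerSeriesHom, hB _ _ z hz]
    rfl
  -- The constant coefficient is the value `c i - 1` at the origin. It is nonzero in general, so
  -- topological rather than formal substitution is needed.
  have ha0 : ∀ i, ‖((constantCoeff (a i) : cyclotomicIntegers p N) : ℂ_[p])‖ < 1 := by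
    intro i
    have h := ha i (fun _ => 0) (fun _ => by simp)
    rw [evalPowerSeries_zero] at h
    simp only [add_zero, one_oneUnitPow, Finset.prod_const_one, mul_one] at h
    exact (congrArg norm h).trans_lt (hc i)
  obtain ⟨F, hF⟩ := exists_evalPowerSeries_comp hA hcl (padicIntToCyclotomicIntegers N) hθ L a ha0
  refine ⟨F, fun z hz => ?_⟩
  rw [hF z hz, hcomp]
  simp only [ha _ z hz]

end Charts

/-! ### Limits of zeros along an ultrafilter. -/

section LimitArguments

open MvPowerSeries Filter Topology

theorem Ultrafilter.exists_eventually_eq {ι β : Type*} (U : Ultrafilter ι) {T : Set β}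
    (hT : T.Finite) {f : ι → β} (hf : ∀ᶠ n in (U : Filter ι), f n ∈ T) :
    ∃ b ∈ T, ∀ᶠ n in (U : Filter ι), f n = b := by
  have h : (⋃ b ∈ T, f ⁻¹' {b}) ∈ U := by
    filter_upwards [hf] with n hn
    exact Set.mem_iUnion₂.mpr ⟨f n, hn, rfl⟩
  rw [Ultrafilter.finite_biUnion_mem_iff hT] at h
  exact h

theorem Ultrafilter.exists_tendsto {ι X : Type*} [TopologicalSpace X] [CompactSpace X]
    (U : Ultrafilter ι) (f : ι → X) : ∃ x, Tendsto f U (𝓝 x) := by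
  obtain ⟨x, -, hx⟩ := isCompact_univ.ultrafilter_le_nhds (U.map f) (by simp)
  exact ⟨x, hx⟩

theorem exists_lt_mul_pow {M M' : ℝ} (h : M' < M) (n : ℕ) :
    ∃ ρ : ℝ, 0 < ρ ∧ ρ < 1 ∧ M' < M * ρ ^ n := by
  have h1 : Tendsto (fun ρ : ℝ => M * ρ ^ n) (𝓝[<] 1) (𝓝 (M * 1 ^ n)) :=
    ((continuous_const.mul (continuous_pow n)).tendsto 1).mono_left nhdsWithin_le_nhds
  rw [one_pow, mul_one] at h1
  obtain ⟨ρ, hρ, hρ1⟩ := ((h1.eventually_const_lt h).and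
    (Ioo_mem_nhdsLT (zero_lt_one' ℝ))).exists
  exact ⟨ρ, hρ1.1, hρ1.2, hρ⟩

variable {p : ℕ} [hp : Fact p.Prime] {u : ℤ_[p]}
  (hu : ((if p = 2 then 4 else p : ℕ) : ℤ_[p]) ∣ u - 1)

theorem fin_two_cases {i₀ i₁ : Fin 2} (hi : i₀ ≠ i₁) (i : Fin 2) : i = i₀ ∨ i = i₁ := by omega

theorem tendsto_natCast_sub_dvd {ι : Type*} {l : Filter ι} {f : ι → ℤ_[p]} {j : ℤ_[p]}
    (hf : Tendsto f l (𝓝 j)) (m : ℕ) :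
    ∀ᶠ n in l, ∃ e : ℤ_[p], f n - j = ((p ^ m : ℕ) : ℤ_[p]) * e := by
  have h1 : Tendsto (fun n => ‖f n - j‖) l (𝓝 0) := tendsto_iff_norm_sub_tendsto_zero.mp hf
  have h2 : (0 : ℝ) < (p : ℝ) ^ (-m : ℤ) := zpow_pos (by exact_mod_cast hp.out.pos) _
  filter_upwards [h1.eventually_lt_const h2] with n hn
  have h3 := (PadicInt.norm_le_pow_iff_mem_span_pow _ _).mp hn.le
  rw [Ideal.mem_span_singleton] at h3
  rw [Nat.cast_pow]
  exact h3

include hu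

/-- Infinitely many zeros in a fixed torsion coset of a line force vanishing along the line. -/
theorem eval_eq_zero_of_zeros_on_line {ι : Type*} (U : Ultrafilter ι) (hu1 : u ≠ 1)
    (L : MvPowerSeries (Fin 2) ℤ_[p]) (ζ : Fin 2 → ℂ_[p]) (hζ : ∀ i, IsPPowerRootOfUnity p (ζ i))
    (k : ι → Fin 2 → ℕ) (k₀ : Fin 2 → ℕ) (i₀ : Fin 2) (v : Fin 2 → ℤ_[p])
    (hk : ∀ᶠ n in (U : Filter ι), ∀ i, (k n i : ℤ_[p]) - k₀ i = v i * ((k n i₀ : ℤ_[p]) - k₀ i₀))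
    (hinf : ∀ m : ℕ, ∀ᶠ n in (U : Filter ι), k n i₀ ≠ m)
    (hzero : ∀ᶠ n in (U : Filter ι), evalPowerSeries (padicIntHom p) L
      (fun i => padicIntHom p u ^ k n i * ζ i - 1) = 0)
    (w : ℂ_[p]) (hw : ‖w - 1‖ < 1) :
    evalPowerSeries (padicIntHom p) L
      (fun i => padicIntHom p u ^ k₀ i * ζ i * oneUnitPow w (v i) - 1) = 0 := by
  set g := padicIntHom p u with hg_def
  have hg : ‖g - 1‖ < 1 := norm_padicIntHom_sub_one_lt hu
  obtain ⟨N₀, hN₀⟩ := hζ 0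
  obtain ⟨N₁, hN₁⟩ := hζ 1
  obtain ⟨N, hN⟩ : ∃ N, ∀ i, ζ i ^ p ^ N = 1 := ⟨N₀ + N₁, fun i => by
    fin_cases i
    · simp [pow_add, pow_mul, hN₀]
    · simp [pow_add, mul_comm (p ^ N₀), pow_mul, hN₁]⟩
  -- The chart is centred at the limit of the exponents, where the zeros accumulate; `e` collects
  -- the limits in both coordinates.
  obtain ⟨κ, hκ⟩ := U.exists_tendsto fun n => (k n i₀ : ℤ_[p])
  have hgA := padicIntHom_mem_cyclotomicIntegers N u
  let e : Fin 2 → ℤ_[p] := fun i => k₀ i + v i * (κ - k₀ i₀)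
  obtain ⟨F, hF⟩ := exists_pullback_series (τ := Fin 1) N L (fun i => oneUnitPow g (e i) * ζ i)
    (fun i => mul_mem (oneUnitPow_mem_cyclotomicIntegers hg hgA _) (mem_cyclotomicIntegers (hN i)))
    (fun i => norm_mul_sub_one_lt (norm_oneUnitPow_sub_one_lt hg _) (hζ i).norm_sub_one_lt)
    (fun i _ => v i)
  simp only [Fin.prod_univ_one] at hF
  have hF0 : F = 0 := by
    by_contra hne
    obtain ⟨ε, hε, hFε⟩ := exists_ne_zero_of_near_zero
      (norm_le_one_of_mem_cyclotomicIntegers (p := p) (N := N)) F hne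
    let t : ι → ℂ_[p] := fun n => oneUnitPow g ((k n i₀ : ℤ_[p]) - κ) - 1
    have ht1 : ∀ n, ‖t n‖ < 1 := fun n => norm_oneUnitPow_sub_one_lt hg _
    have ht : Tendsto (fun n => ‖t n‖) U (𝓝 0) := by
      have h1 : Tendsto (fun n => (k n i₀ : ℤ_[p]) - κ) U (𝓝 0) := by
        simpa using hκ.sub_const κ
      have h2 := (((continuous_oneUnitPow hg).tendsto 0).comp h1).sub_const 1
      rw [oneUnitPow_zero, sub_self] at h2
      exact tendsto_zero_iff_norm_tendsto_zero.mp h2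
    -- The zeros must differ from the centre: if `κ` is a natural number this is `hinf`, otherwise
    -- it is automatic.
    have hκne : ∀ᶠ n in (U : Filter ι), (k n i₀ : ℤ_[p]) ≠ κ := by
      by_cases hm : ∃ m : ℕ, (m : ℤ_[p]) = κ
      · obtain ⟨m, rfl⟩ := hm
        filter_upwards [hinf m] with n hn
        exact_mod_cast hn
      · exact Eventually.of_forall fun n h => hm ⟨_, h⟩
    obtain ⟨n, hn1, hn2, hn3, hn4⟩ :=
      ((ht.eventually_lt_const hε).and (hκne.and (hk.and hzero))).exists
    refine hFε (fun _ => t n) (fun _ => ht1 n) (fun h => hn2 ?_) hn1 ?_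
    · exact sub_eq_zero.mp (oneUnitPow_padicIntHom_eq_one hu hu1 (sub_eq_zero.mp h))
    · rw [hF _ fun _ => ht1 n, ← hn4]
      congr 1
      ext1 i
      have h3 : ((k n i : ℕ) : ℤ_[p]) = e i + ((k n i₀ : ℤ_[p]) - κ) * v i := by
        linear_combination hn3 i
      rw [add_sub_cancel, ← oneUnitPow_mul hg, ← oneUnitPow_natCast, h3, oneUnitPow_add hg (e i)]
      ring
  -- Moving the base point from the limit exponents back to `k₀` multiplies the parameter by a power
  -- of `g`.
  have hs : ‖oneUnitPow g ((k₀ i₀ : ℤ_[p]) - κ) * w - 1‖ < 1 :=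
    norm_mul_sub_one_lt (norm_oneUnitPow_sub_one_lt hg _) hw
  have h := hF (fun _ => oneUnitPow g ((k₀ i₀ : ℤ_[p]) - κ) * w - 1) fun _ => hs
  rw [hF0] at h
  rw [show evalPowerSeries (cyclotomicIntegers p N).subtype 0
    (fun _ : Fin 1 => oneUnitPow g ((k₀ i₀ : ℤ_[p]) - κ) * w - 1) = 0 by simp [evalPowerSeries]] at h
  rw [h]
  congr 1
  ext1 i
  rw [add_sub_cancel, mul_oneUnitPow (norm_oneUnitPow_sub_one_lt hg _) hw, ← oneUnitPow_mul hg,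
    ← oneUnitPow_natCast g (k₀ i)]
  have h3 : ((k₀ i : ℕ) : ℤ_[p]) = e i + ((k₀ i₀ : ℤ_[p]) - κ) * v i := by
    simp only [e]; ring
  rw [h3, oneUnitPow_add hg (e i)]
  ring

/-- Zeros of unbounded torsion order force vanishing along a line. -/
theorem exists_eval_eq_zero_of_unbounded_order {ι : Type*} (U : Ultrafilter ι)
    (L : MvPowerSeries (Fin 2) ℤ_[p]) (ζ : ι → Fin 2 → ℂ_[p])
    (hζ : ∀ n i, IsPPowerRootOfUnity p (ζ n i)) (k : ι → Fin 2 → ℕ) {i₀ i₁ : Fin 2} (hi : i₀ ≠ i₁)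
    (hpow : ∀ᶠ n in (U : Filter ι), ∃ c : ℕ, ζ n i₁ = ζ n i₀ ^ c)
    (hord : ∀ N : ℕ, ∀ᶠ n in (U : Filter ι), ζ n i₀ ^ p ^ N ≠ 1)
    (hzero : ∀ n, evalPowerSeries (padicIntHom p) L
      (fun i => padicIntHom p u ^ k n i * ζ n i - 1) = 0) :
    ∃ v : Fin 2 → ℤ_[p], v i₀ = 1 ∧ ∃ n, ∀ w : ℂ_[p], ‖w - 1‖ < 1 →
      evalPowerSeries (padicIntHom p) L
        (fun i => padicIntHom p u ^ k n i * ζ n i * oneUnitPow w (v i) - 1) = 0 := by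
  classical
  set g := padicIntHom p u with hg_def
  have hg : ‖g - 1‖ < 1 := norm_padicIntHom_sub_one_lt hu
  have hg1 : ∀ j, ‖oneUnitPow g j - 1‖ < 1 := norm_oneUnitPow_sub_one_lt hg
  obtain ⟨c, hc⟩ : ∃ c : ι → ℕ, ∀ᶠ n in (U : Filter ι), ζ n i₁ = ζ n i₀ ^ c n := by
    refine ⟨fun n => if h : ∃ c : ℕ, ζ n i₁ = ζ n i₀ ^ c then h.choose else 0, ?_⟩
    filter_upwards [hpow] with n hn
    simp only [dif_pos hn]
    exact hn.choose_spec
  obtain ⟨j, hj⟩ := U.exists_tendsto fun n => (c n : ℤ_[p])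
  let v : Fin 2 → ℤ_[p] := fun i => if i = i₀ then 1 else j
  have hv0 : v i₀ = 1 := if_pos rfl
  have hv1 : v i₁ = j := if_neg hi.symm
  refine ⟨v, hv0, ?_⟩
  -- The exponents of the chart: coordinate `i₀` is `1 + x`, coordinate `i₁` is `(1 + x) ^ j * (1 +
  -- y)`. At the `n`-th zero `1 + y` has torsion part `η n` and free part `g ^ t n`.
  let e : Fin 2 → Fin 2 → ℤ_[p] := fun i => ![v i, if i = i₀ then 0 else 1]
  let η : ι → ℂ_[p] := fun n => oneUnitPow (ζ n i₀) ((c n : ℤ_[p]) - j)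
  let t : ι → ℤ_[p] := fun n => k n i₁ - j * k n i₀
  have hη : ∀ n, IsPPowerRootOfUnity p (η n) := fun n => (hζ n i₀).oneUnitPow _
  let x : ι → ℂ_[p] := fun n => g ^ k n i₀ * ζ n i₀ - 1
  have hx1 : ∀ n, ‖x n‖ < 1 := fun n =>
    norm_mul_sub_one_lt (norm_pow_sub_one_lt hg _) (hζ n i₀).norm_sub_one_lt
  have hx : ∀ᶠ n in (U : Filter ι), ‖x n‖ = ‖ζ n i₀ - 1‖ := by
    filter_upwards [hord 0] with n hn
    have := norm_oneUnitPow_mul_sub_one hu (hζ n i₀) (by simpa using hn) (k n i₀ : ℤ_[p])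
    rwa [oneUnitPow_natCast] at this
  have hxρ : ∀ ρ : ℝ, ρ < 1 → ∀ᶠ n in (U : Filter ι), ρ < ‖x n‖ := fun ρ hρ => by
    obtain ⟨N, hN⟩ := exists_lt_norm_sub_one (p := p) hρ
    filter_upwards [hx, hord N] with n h1 h2
    rw [h1]
    exact hN _ (hζ n i₀) h2
  have hcoord : ∀ n, ζ n i₁ = ζ n i₀ ^ c n → ∀ i,
      g ^ k n i * ζ n i =
        oneUnitPow (1 + x n) (e i 0) * oneUnitPow (oneUnitPow g (t n) * η n) (e i 1) := by
    intro n hn i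
    have hζ1 := (hζ n i₀).norm_sub_one_lt
    rw [show 1 + x n = g ^ k n i₀ * ζ n i₀ by simp [x]]
    rcases fin_two_cases hi i with rfl | rfl
    · simp [e, hv0, oneUnitPow_one, oneUnitPow_zero]
    · have h1 : oneUnitPow (ζ n i₀) j * η n = ζ n i := by
        rw [← oneUnitPow_add hζ1, add_sub_cancel, oneUnitPow_natCast, hn]
      have h2 : oneUnitPow (g ^ k n i₀) j * oneUnitPow g (t n) = g ^ k n i := by
        rw [← oneUnitPow_natCast_mul hg, ← oneUnitPow_add hg, ← oneUnitPow_natCast g (k n i)]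
        congr 1
        simp only [t]
        ring
      simp only [e, Matrix.cons_val_zero, Matrix.cons_val_one, hv1, if_neg hi.symm, oneUnitPow_one]
      rw [mul_oneUnitPow (norm_pow_sub_one_lt hg _) hζ1, ← h1, ← h2]
      ring
  have hline : ∀ n, ∀ w : ℂ_[p], ‖w - 1‖ < 1 → ∀ i,
      oneUnitPow (1 + ((1 + x n) * w - 1)) (e i 0) = oneUnitPow (1 + x n) (e i 0) *
        oneUnitPow w (v i) := by
    intro n w hw i
    rw [add_sub_cancel, mul_oneUnitPow (by simpa using hx1 n) hw]
    rfl
  have hxw : ∀ n, ∀ w : ℂ_[p], ‖w - 1‖ < 1 → ‖(1 + x n) * w - 1‖ < 1 := fun n w hw =>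
    norm_mul_sub_one_lt (by simpa using hx1 n) hw
  by_cases hb : ∀ N : ℕ, ∀ᶠ n in (U : Filter ι), η n ^ p ^ N ≠ 1
  · let y : ι → ℂ_[p] := fun n => oneUnitPow g (t n) * η n - 1
    have hy1 : ∀ n, ‖y n‖ < 1 := fun n => norm_mul_sub_one_lt (hg1 _) (hη n).norm_sub_one_lt
    have hz1 : ∀ n, ∀ i, ‖![x n, y n] i‖ < 1 := fun n i => by
      fin_cases i
      · exact hx1 n
      · exact hy1 n
    have hy : ∀ᶠ n in (U : Filter ι), ‖y n‖ = ‖η n - 1‖ := by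
      filter_upwards [hb 0] with n hn
      exact norm_oneUnitPow_mul_sub_one hu (hη n) (by simpa using hn) _
    obtain ⟨F, hF⟩ := exists_pullback_series (τ := Fin 2) 0 L (fun _ => 1) (fun _ => one_mem _)
      (by simp) e
    simp only [Fin.prod_univ_two, one_mul] at hF
    by_cases hF0 : F = 0
    · obtain ⟨n, hn⟩ := hc.exists
      refine ⟨n, fun w hw => ?_⟩
      have h := hF ![(1 + x n) * w - 1, y n] fun i => by
        fin_cases i
        · exact hxw n w hw
        · exact hy1 n
      rw [hF0, show evalPowerSeries (cyclotomicIntegers p 0).subtype 0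
        ![(1 + x n) * w - 1, y n] = 0 by simp [evalPowerSeries]] at h
      rw [h]
      congr 1
      ext1 i
      simp only [Matrix.cons_val_zero, Matrix.cons_val_one]
      rw [hcoord n hn i, hline n w hw i, show 1 + y n = oneUnitPow g (t n) * η n by simp [y]]
      ring
    · exfalso
      obtain ⟨M, M', l, d, hM', hMM', hne⟩ := exists_ne_zero_of_norm_near_one
        norm_le_one_of_mem_cyclotomicIntegers (isCompact_cyclotomicIntegers p 0) F hF0
      obtain ⟨ρ, hρ0, hρ1, hρ⟩ := exists_lt_mul_pow hMM' (l + d)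
      -- Once `p ^ m` divides `c n - j`, the residue `η n` is a power of `ζ n i₀ ^ p ^ m`, which
      -- gives `‖y n‖ ≤ ‖x n‖ ^ p ^ m < ‖x n‖ ^ l`.
      obtain ⟨m, hm⟩ : ∃ m, l < p ^ m := ⟨l, Nat.lt_pow_self hp.out.one_lt⟩
      obtain ⟨N, hN⟩ := exists_lt_norm_sub_one (p := p) hρ1
      obtain ⟨n, hn1, hn2, hn3, hn4, hn5, hn6, hn7⟩ := (hc.and (hx.and (hy.and ((hxρ ρ hρ1).and
        ((hb N).and ((tendsto_natCast_sub_dvd hj m).and (hord 0))))))).exists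
      refine hne ![x n, y n] (hz1 n) ?_ ?_ ?_
      · refine hρ.trans_le (mul_le_mul_of_nonneg_left ?_ (hM'.trans hMM').le)
        rw [pow_add]
        have hy2 : ρ < ‖y n‖ := by rw [hn3]; exact hN _ (hη n) hn5
        exact mul_le_mul (pow_le_pow_left₀ hρ0.le hn4.le l) (pow_le_pow_left₀ hρ0.le hy2.le d)
          (by positivity) (by positivity)
      · obtain ⟨b, hb'⟩ := hn6
        change ‖y n‖ < ‖x n‖ ^ l
        rw [hn3, hn2]
        have h1 : η n = oneUnitPow (ζ n i₀ ^ p ^ m) b := by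
          simp only [η]
          rw [hb', oneUnitPow_natCast_mul (hζ n i₀).norm_sub_one_lt]
        rw [h1]
        refine (norm_oneUnitPow_sub_one_le ((hζ n i₀).pow _).norm_sub_one_lt b).trans_lt
          (((hζ n i₀).norm_pow_prime_pow_sub_one_le m).trans_lt ?_)
        refine pow_lt_pow_right_of_lt_one₀ ?_ (hζ n i₀).norm_sub_one_lt hm
        rw [norm_pos_iff, sub_ne_zero]
        simpa using hn7
      · rw [hF _ (hz1 n), ← hzero n]
        congr 1
        ext1 i
        rw [hcoord n hn1 i]
        simp [y]
  · push Not at hb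
    obtain ⟨N, hN⟩ := hb
    -- The torsion part is now constant and its exponent `t n` has a limit `s`, so `1 + y` is
    -- recentred at `b = g ^ s * ξ`.
    obtain ⟨ξ, hξ, hηξ⟩ := U.exists_eventually_eq (finite_setOf_pow_eq_one N) hN
    have hξ' : IsPPowerRootOfUnity p ξ := ⟨N, hξ⟩
    obtain ⟨s, hs⟩ := U.exists_tendsto t
    let y : ι → ℂ_[p] := fun n => oneUnitPow g (t n - s) - 1
    have hy1 : ∀ n, ‖y n‖ < 1 := fun n => hg1 _
    have hy : Tendsto (fun n => ‖y n‖) U (𝓝 0) := by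
      have h1 : Tendsto (fun n => t n - s) U (𝓝 0) := by
        simpa using hs.sub_const s
      have h2 := (((continuous_oneUnitPow hg).tendsto 0).comp h1).sub_const 1
      rw [oneUnitPow_zero, sub_self] at h2
      exact tendsto_zero_iff_norm_tendsto_zero.mp h2
    have hz1 : ∀ n, ∀ i, ‖![x n, y n] i‖ < 1 := fun n i => by
      fin_cases i
      · exact hx1 n
      · exact hy1 n
    let b : ℂ_[p] := oneUnitPow g s * ξ
    have hb1 : ‖b - 1‖ < 1 := norm_mul_sub_one_lt (hg1 s) hξ'.norm_sub_one_lt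
    have hbA : b ∈ cyclotomicIntegers p N := mul_mem (oneUnitPow_mem_cyclotomicIntegers hg
      (padicIntHom_mem_cyclotomicIntegers N u) s) (mem_cyclotomicIntegers hξ)
    have hby : ∀ n, b * (1 + y n) = oneUnitPow g (t n) * ξ := fun n => by
      simp only [b, y]
      rw [add_sub_cancel, mul_right_comm, ← oneUnitPow_add hg, add_sub_cancel]
    obtain ⟨F, hF⟩ := exists_pullback_series (τ := Fin 2) N L (fun i => oneUnitPow b (e i 1))
      (fun i => oneUnitPow_mem_cyclotomicIntegers hb1 hbA _)
      (fun i => norm_oneUnitPow_sub_one_lt hb1 _) e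
    simp only [Fin.prod_univ_two] at hF
    have hpt : ∀ n, η n = ξ → ∀ i, oneUnitPow (oneUnitPow g (t n) * η n) (e i 1) =
        oneUnitPow b (e i 1) * oneUnitPow (1 + y n) (e i 1) := fun n hn i => by
      rw [hn, ← hby n, mul_oneUnitPow hb1 (by simpa using hy1 n)]
    have hconcl : ∀ n, ζ n i₁ = ζ n i₀ ^ c n → η n = ξ →
        (∀ x', ‖x'‖ < 1 →
          evalPowerSeries (cyclotomicIntegers p N).subtype F ![x', y n] = 0) →
        ∃ n, ∀ w : ℂ_[p], ‖w - 1‖ < 1 → evalPowerSeries (padicIntHom p) L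
          (fun i => g ^ k n i * ζ n i * oneUnitPow w (v i) - 1) = 0 := by
      intro n hn1 hn2 hvan
      refine ⟨n, fun w hw => ?_⟩
      rw [← hvan _ (hxw n w hw), hF _ fun i => by
        fin_cases i
        · exact hxw n w hw
        · exact hy1 n]
      congr 1
      ext1 i
      simp only [Matrix.cons_val_zero, Matrix.cons_val_one]
      rw [hcoord n hn1 i, hline n w hw i, hpt n hn2 i]
      ring
    by_cases hF0 : F = 0
    · obtain ⟨n, hn1, hn2⟩ := (hc.and hηξ).exists
      exact hconcl n hn1 hn2 fun x' _ => by simp [hF0, evalPowerSeries]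
    · obtain ⟨M, M', l, r, hM', hMM', hr, hne⟩ := exists_ne_zero_of_near_axis
        norm_le_one_of_mem_cyclotomicIntegers (isCompact_cyclotomicIntegers p N) F hF0
      obtain ⟨ρ, hρ0, hρ1, hρ⟩ := exists_lt_mul_pow hMM' l
      obtain ⟨n, hn1, hn2, hn3, hn4⟩ := (hc.and (hηξ.and ((hxρ ρ hρ1).and
        (hy.eventually_lt_const hM')))).exists
      have hxM : M' < M * ‖x n‖ ^ l := hρ.trans_le (mul_le_mul_of_nonneg_left
        (pow_le_pow_left₀ hρ0.le hn3.le l) (hM'.trans hMM').le)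
      have hFz : evalPowerSeries (cyclotomicIntegers p N).subtype F ![x n, y n] = 0 := by
        rw [hF _ (hz1 n), ← hzero n]
        congr 1
        ext1 i
        simp only [Matrix.cons_val_zero, Matrix.cons_val_one]
        rw [hcoord n hn1 i, hpt n hn2 i]
        ring
      -- A zero this close to the axis must lie on it, with `F` divisible by `y`; the axis is then
      -- the required line through this zero.
      have h1 : ¬ (y n ≠ 0 ∨ r = 0) := fun h =>
        hne ![x n, y n] (hz1 n) hxM (hn4.trans hxM) h hFz
      push Not at h1
      refine hconcl n hn1 hn2 fun x' hx' => ?_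
      rw [h1.1]
      exact (hr.resolve_left h1.2) x' hx'

end LimitArguments

/-! ### Homomorphisms of formal tori as multiplicative maps on one-units. -/

section FormalTorusHomomorphisms

open MvPowerSeries Filter Topology

variable {p : ℕ} [hp : Fact p.Prime]

/-- The map on one-units induced by a coordinate of a homomorphism of formal tori. -/
noncomputable def FormalTorusHom.onUnits {m n : ℕ} (f : FormalTorusHom ℤ_[p] m n) (i : Fin n)
    (w : Fin m → ℂ_[p]) : ℂ_[p] :=
  1 + evalPowerSeries (padicIntHom p) (f.toSeries i) (w - 1)

variable {m n : ℕ} (f : FormalTorusHom ℤ_[p] m n) (i : Fin n)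

theorem FormalTorusHom.onUnits_mul {w w' : Fin m → ℂ_[p]} (hw : ∀ j, ‖w j - 1‖ < 1)
    (hw' : ∀ j, ‖w' j - 1‖ < 1) : f.onUnits i (w * w') = f.onUnits i w * f.onUnits i w' := by
  have hφ := norm_padicIntHom_le_one p
  have hz : ∀ t, ‖Sum.elim (w - 1) (w' - 1) t‖ < 1 := by
    rintro (j | j)
    · exact hw j
    · exact hw' j
  have h := congrArg (fun F => evalPowerSeries (padicIntHom p) F (Sum.elim (w - 1) (w' - 1)))
    (f.map_law i)
  have h1 : HasSubst fun i => (X (Sum.inl i) : MvPowerSeries (Fin m ⊕ Fin m) ℤ_[p]) :=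
    hasSubst_of_constantCoeff_zero fun _ => by simp
  have h2 : HasSubst fun i => (X (Sum.inr i) : MvPowerSeries (Fin m ⊕ Fin m) ℤ_[p]) :=
    hasSubst_of_constantCoeff_zero fun _ => by simp
  rw [subst_multiplicative_law _ _
    (constantCoeff_subst_eq_zero h1 (fun _ => by simp) (f.constantCoeff_eq_zero i))
    (constantCoeff_subst_eq_zero h2 (fun _ => by simp) (f.constantCoeff_eq_zero i)),
    evalPowerSeries_subst hφ hz constantCoeff_formalTorusLaw, evalPowerSeries_add hφ hz,
    evalPowerSeries_add hφ hz, evalPowerSeries_mul hφ hz,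
    evalPowerSeries_subst hφ hz (fun _ => by simp), evalPowerSeries_subst hφ hz (fun _ => by simp)]
    at h
  simp only [formalTorusLaw_apply, evalPowerSeries_add hφ hz, evalPowerSeries_mul hφ hz,
    evalPowerSeries_X hφ hz, Sum.elim_inl, Sum.elim_inr] at h
  have h3 : w * w' - 1 = fun j => (w - 1) j + (w' - 1) j + (w - 1) j * (w' - 1) j := by
    ext1 j
    simp only [Pi.sub_apply, Pi.mul_apply, Pi.one_apply]
    ring
  have e1 : (fun j => (w - 1) j) = w - 1 := rfl
  have e2 : (fun j => (w' - 1) j) = w' - 1 := rfl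
  rw [e1, e2] at h
  rw [onUnits, onUnits, onUnits, h3, h]
  ring

theorem FormalTorusHom.onUnits_one : f.onUnits i 1 = 1 := by
  have h := evalPowerSeries_zero (padicIntHom p) (f.toSeries i)
  rw [f.constantCoeff_eq_zero, map_zero] at h
  rw [onUnits, sub_self]
  change 1 + evalPowerSeries _ _ (fun _ => 0) = 1
  rw [h, add_zero]

theorem FormalTorusHom.onUnits_pow {w : Fin m → ℂ_[p]} (hw : ∀ j, ‖w j - 1‖ < 1) (k : ℕ) :
    f.onUnits i (w ^ k) = f.onUnits i w ^ k := by
  induction k with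
  | zero => rw [pow_zero, pow_zero, onUnits_one]
  | succ k ih => rw [pow_succ, f.onUnits_mul (w := w ^ k) i (fun j => norm_pow_sub_one_lt (hw j) k) hw, ih,
      pow_succ]

theorem FormalTorusHom.isPPowerRootOfUnity_onUnits {w : Fin m → ℂ_[p]} {N : ℕ}
    (hw : w ^ p ^ N = 1) : IsPPowerRootOfUnity p (f.onUnits i w) := by
  refine ⟨N, ?_⟩
  rw [← f.onUnits_pow i (fun j => IsPPowerRootOfUnity.norm_sub_one_lt ⟨N, congrFun hw j⟩), hw,
    f.onUnits_one]

/-- Without constant term every monomial takes a value divisible by `q`, and `q ℤ_p` is closed, so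
the sum stays in it. -/
theorem FormalTorusHom.exists_onUnits_eq {q : ℤ_[p]} {x : Fin m → ℤ_[p]} (hx : ∀ j, q ∣ x j - 1)
    (hx1 : ∀ j, ‖padicIntHom p (x j) - 1‖ < 1) :
    ∃ u : ℤ_[p], q ∣ u - 1 ∧ f.onUnits i (fun j => padicIntHom p (x j)) = padicIntHom p u := by
  let T : AddSubgroup ℂ_[p] :=
    ((padicIntHom p).toAddMonoidHom.comp (AddMonoidHom.mulLeft q)).range
  have hT : IsClosed (T : Set ℂ_[p]) :=
    (isCompact_range ((continuous_padicIntHom p).comp (continuous_const_mul q))).isClosed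
  have hs := hasSum_evalPowerSeries (norm_padicIntHom_le_one p) hx1 (f.toSeries i)
  have hmem : evalPowerSeries (padicIntHom p) (f.toSeries i)
      (fun j => padicIntHom p (x j) - 1) ∈ T := by
    refine hT.mem_of_tendsto hs (Eventually.of_forall fun s => sum_mem fun e _ => ?_)
    have hq : q ∣ coeff e (f.toSeries i) * ∏ j, (x j - 1) ^ e j := by
      by_cases he : e = 0
      · rw [he, coeff_zero_eq_constantCoeff_apply, f.constantCoeff_eq_zero, zero_mul]
        exact dvd_zero q
      · obtain ⟨j, hj⟩ := Finsupp.ne_iff.mp he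
        exact ((dvd_pow (hx j) hj).trans
          (Finset.dvd_prod_of_mem (fun j => (x j - 1) ^ e j) (Finset.mem_univ j))).mul_left _
    obtain ⟨c, hc⟩ := hq
    refine ⟨c, ?_⟩
    change padicIntHom p (q * c) = _
    rw [← hc]
    simp
  obtain ⟨c, hc⟩ := hmem
  refine ⟨1 + q * c, by rw [add_sub_cancel_left]; exact dvd_mul_right q c, ?_⟩
  rw [map_add, map_one, onUnits]
  exact congrArg (1 + ·) hc.symm

end FormalTorusHomomorphisms

/-! ### Formal characters as linear forms in the exponents. -/

section FormalCharacters

open MvPowerSeries Filter Topology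

variable {p : ℕ} [hp : Fact p.Prime]

theorem tendsto_prime_pow_zero : Tendsto (fun m : ℕ => ((p ^ m : ℕ) : ℤ_[p])) atTop (𝓝 0) := by
  have h : Tendsto (fun m : ℕ => (p : ℤ_[p]) ^ m) atTop (𝓝 0) :=
    tendsto_pow_atTop_nhds_zero_of_norm_lt_one (by
      rw [PadicInt.norm_p]; exact inv_prime_lt_one)
  simpa using h

/-- A power series that vanishes on the open polydisc is zero. -/
theorem eq_zero_of_forall_evalPowerSeries_eq_zero (F : MvPowerSeries (Fin 2) ℤ_[p])
    (hF : ∀ z : Fin 2 → ℂ_[p], (∀ i, ‖z i‖ < 1) → evalPowerSeries (padicIntHom p) F z = 0) :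
    F = 0 := by
  by_contra hne
  have hmap : MvPowerSeries.map (padicIntToCyclotomicIntegers (p := p) 0) F ≠ 0 := by
    intro h
    refine hne (MvPowerSeries.ext fun e => padicIntHom_injective p ?_)
    have h1 := congrArg (fun G => ((coeff e G : cyclotomicIntegers p 0) : ℂ_[p])) h
    simp only [coeff_map, coeff_zero] at h1
    rw [coeff_zero, map_zero]
    exact h1
  obtain ⟨M, M', l, r, hM', hMM', -, hz⟩ := exists_ne_zero_of_near_axis
    norm_le_one_of_mem_cyclotomicIntegers (isCompact_cyclotomicIntegers p 0) _ hmap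
  obtain ⟨ρ, hρ0, hρ1, hρ⟩ := exists_lt_mul_pow hMM' l
  obtain ⟨N, hN⟩ := exists_lt_norm_sub_one (p := p) hρ1
  obtain ⟨ζ, hζ, hζN⟩ := infinite_setOf_isPPowerRootOfUnity.exists_notMem_finite
    (finite_setOf_pow_eq_one (p := p) N)
  have hx := hN ζ hζ hζN
  have ht : Tendsto (fun m : ℕ => ‖((p ^ m : ℕ) : ℤ_[p])‖) atTop (𝓝 0) :=
    tendsto_zero_iff_norm_tendsto_zero.mp tendsto_prime_pow_zero
  obtain ⟨m, hm, hm1⟩ := ((ht.eventually_lt_const hM').and (eventually_gt_atTop 0)).exists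
  have hxM : M' < M * ‖ζ - 1‖ ^ l := hρ.trans_le (mul_le_mul_of_nonneg_left
    (pow_le_pow_left₀ hρ0.le hx.le l) (hM'.trans hMM').le)
  have hlt : ∀ i, ‖![ζ - 1, padicIntHom p ((p ^ m : ℕ) : ℤ_[p])] i‖ < 1 := fun i => by
    fin_cases i
    · exact hζ.norm_sub_one_lt
    · change ‖padicIntHom p _‖ < 1
      rw [norm_padicIntHom, Nat.cast_pow, norm_pow, PadicInt.norm_p]
      exact pow_lt_one₀ inv_prime_pos.le inv_prime_lt_one hm1.ne'
  -- A test point with first coordinate of norm near one and second coordinate small but nonzero.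
  refine hz ![ζ - 1, padicIntHom p ((p ^ m : ℕ) : ℤ_[p])] hlt hxM ?_ (Or.inl ?_) (hF _ hlt)
  · refine lt_trans ?_ hxM
    change ‖padicIntHom p _‖ < M'
    rwa [norm_padicIntHom]
  · change padicIntHom p _ ≠ 0
    rw [map_natCast, Nat.cast_ne_zero]
    exact (pow_pos hp.out.pos m).ne'

variable (χ : FormalCharacter ℤ_[p] 2) {γ : ℤ_[p]ˣ} (hγ : IsTopologicalGenerator p γ)

include hγ

/-- Triviality at `γ` gives triviality at all `γ ^ p ^ m`, which accumulate at one without reaching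
it, so the restriction to the axis is the zero series. -/
theorem onUnits_axis_eq_one (i : Fin 2)
    (h : χ.onUnits 0 (Function.update 1 i (padicIntHom p γ)) = 1) {w : ℂ_[p]} (hw : ‖w - 1‖ < 1) :
    χ.onUnits 0 (Function.update 1 i w) = 1 := by
  classical
  have hg := norm_padicIntHom_sub_one_lt hγ.dvd_sub_one
  obtain ⟨F, hF⟩ := exists_pullback_series (τ := Fin 1) 0 (χ.toSeries 0) (fun _ => 1)
    (fun _ => one_mem _) (by simp) (fun k _ => if k = i then 1 else 0)
  have hupd : ∀ z : ℂ_[p], ‖z‖ < 1 → 1 + evalPowerSeries (cyclotomicIntegers p 0).subtype F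
      (fun _ => z) = χ.onUnits 0 (Function.update 1 i (1 + z)) := fun z hz => by
    rw [hF _ fun _ => hz, FormalTorusHom.onUnits]
    congr 2
    ext1 k
    by_cases hk : k = i
    · subst hk
      simp [oneUnitPow_one]
    · simp [hk, oneUnitPow_zero]
  have hpow : ∀ k : ℕ, χ.onUnits 0 (Function.update 1 i (padicIntHom p γ ^ k)) = 1 := fun k => by
    have h1 := χ.onUnits_pow 0 (w := Function.update 1 i (padicIntHom p γ)) (fun j => by
      by_cases hj : j = i
      · subst hj; simpa using hg
      · simp [hj]) k
    rw [h, one_pow] at h1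
    rw [← h1]
    congr 1
    ext1 j
    by_cases hj : j = i
    · subst hj; simp
    · simp [hj]
  have hF0 : F = 0 := by
    by_contra hne
    obtain ⟨ε, hε, hFε⟩ := exists_ne_zero_of_near_zero
      (norm_le_one_of_mem_cyclotomicIntegers (p := p) (N := 0)) F hne
    have ht := (((continuous_oneUnitPow hg).tendsto 0).comp
      (tendsto_prime_pow_zero (p := p))).sub_const 1
    rw [oneUnitPow_zero, sub_self] at ht
    obtain ⟨m, hm⟩ := ((tendsto_zero_iff_norm_tendsto_zero.mp ht).eventually_lt_const hε).exists
    simp only [Function.comp_apply, oneUnitPow_natCast] at hm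
    have hlt := norm_pow_sub_one_lt hg (p ^ m)
    refine hFε (fun _ => padicIntHom p γ ^ p ^ m - 1) (fun _ => hlt) (fun h0 => ?_) hm ?_
    · rw [← oneUnitPow_natCast, sub_eq_zero] at h0
      have h1 := oneUnitPow_padicIntHom_eq_one hγ.dvd_sub_one hγ.ne_one h0
      exact (pow_pos hp.out.pos m).ne' (by exact_mod_cast h1)
    · have h1 := hupd _ hlt
      rw [add_sub_cancel, hpow] at h1
      exact add_eq_left.mp h1
  have h1 := hupd (w - 1) hw
  rw [add_sub_cancel, hF0] at h1
  rw [← h1]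
  simp [evalPowerSeries]

/-- On the points `(γ ^ k - 1, γ ^ s - 1)` a nontrivial formal character is given by a nonzero
linear form in the exponents. -/
theorem exists_linear_form (hχ : χ.toSeries 0 ≠ 0) :
    ∃ α : Fin 2 → ℤ_[p], α ≠ 0 ∧ ∀ k s : ℕ,
      padicEval p (χ.toSeries 0) (interpolationPoint p γ k s 1 1) =
        oneUnitPow (padicIntHom p γ) (α 0 * k + α 1 * s) - 1 := by
  classical
  have hg := norm_padicIntHom_sub_one_lt hγ.dvd_sub_one
  have hupd : ∀ (i : Fin 2) {w : ℂ_[p]}, ‖w - 1‖ < 1 →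
      ∀ j, ‖(Function.update 1 i w : Fin 2 → ℂ_[p]) j - 1‖ < 1 := fun i w hw j => by
    by_cases hj : j = i
    · subst hj; simpa using hw
    · simp [hj]
  have hsplit : ∀ w : Fin 2 → ℂ_[p], (∀ j, ‖w j - 1‖ < 1) → χ.onUnits 0 w =
      χ.onUnits 0 (Function.update 1 0 (w 0)) * χ.onUnits 0 (Function.update 1 1 (w 1)) := by
    intro w hw
    rw [← χ.onUnits_mul 0 (hupd 0 (hw 0)) (hupd 1 (hw 1))]
    congr 1
    ext1 j
    fin_cases j <;> simp
  have hα : ∀ i : Fin 2, ∃ a : ℤ_[p],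
      χ.onUnits 0 (Function.update 1 i (padicIntHom p γ)) = oneUnitPow (padicIntHom p γ) a := by
    intro i
    have hx : (Function.update 1 i (padicIntHom p γ) : Fin 2 → ℂ_[p]) =
        fun j => padicIntHom p ((Function.update 1 i (γ : ℤ_[p]) : Fin 2 → ℤ_[p]) j) := by
      ext1 j
      by_cases hj : j = i
      · subst hj; simp
      · simp [hj]
    obtain ⟨u, hu, hu'⟩ := χ.exists_onUnits_eq 0
      (q := ((if p = 2 then 4 else p : ℕ) : ℤ_[p]))
      (x := Function.update 1 i (γ : ℤ_[p])) (fun j => by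
        by_cases hj : j = i
        · subst hj; simpa using hγ.dvd_sub_one
        · simp [hj]) (fun j => by
          have := hupd i hg j
          rwa [hx] at this)
    rw [hx, hu']
    exact hγ.exists_eq_oneUnitPow hu
  choose α hα using hα
  -- If both coefficients vanish, the character is trivial on both axes, hence on all points, and
  -- its series is zero.
  refine ⟨α, fun h0 => hχ (eq_zero_of_forall_evalPowerSeries_eq_zero _ fun z hz => ?_),
    fun k s => ?_⟩
  · have h1 := hsplit (1 + z) (fun j => by simpa using hz j)
    have hα1 : ∀ i, χ.onUnits 0 (Function.update 1 i (padicIntHom p γ)) = 1 := fun i => by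
      rw [hα, h0, Pi.zero_apply, oneUnitPow_zero]
    rw [onUnits_axis_eq_one χ hγ 0 (hα1 0) (by simpa using hz 0),
      onUnits_axis_eq_one χ hγ 1 (hα1 1) (by simpa using hz 1), mul_one, FormalTorusHom.onUnits,
      add_sub_cancel_left] at h1
    exact add_eq_left.mp h1
  · have hpow : ∀ (i : Fin 2) (k : ℕ),
        χ.onUnits 0 (Function.update 1 i (padicIntHom p γ ^ k)) =
          oneUnitPow (padicIntHom p γ) (α i * k) := fun i k => by
      rw [oneUnitPow_mul hg, oneUnitPow_natCast, ← hα, ← χ.onUnits_pow 0 (hupd i hg)]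
      congr 1
      ext1 j
      by_cases hj : j = i
      · subst hj; simp
      · simp [hj]
    have h1 := hsplit ![padicIntHom p γ ^ k, padicIntHom p γ ^ s] (fun j => by
      fin_cases j
      · exact norm_pow_sub_one_lt hg k
      · exact norm_pow_sub_one_lt hg s)
    simp only [Matrix.cons_val_zero, Matrix.cons_val_one, hpow] at h1
    rw [oneUnitPow_add hg, ← h1, FormalTorusHom.onUnits, add_sub_cancel_left,
      padicEval_eq_evalPowerSeries]
    congr 1
    ext1 j
    fin_cases j <;> simp [interpolationPoint, padicIntHom_apply]

end FormalCharacters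

/-! ### The dichotomy and its exclusivity. -/

section MainTheorem

open MvPowerSeries Filter Topology

variable {p : ℕ} [hp : Fact p.Prime] {γ : ℤ_[p]ˣ}

theorem interpolationPoint_apply (k : Fin 2 → ℕ) (ζ : Fin 2 → ℂ_[p]) :
    interpolationPoint p γ (k 0) (k 1) (ζ 0) (ζ 1) =
      fun i => padicIntHom p γ ^ k i * ζ i - 1 := by
  ext1 i
  fin_cases i <;> rfl

theorem exists_of_mem_interpolationPoints {P : Fin 2 → ℂ_[p]}
    (h : P ∈ interpolationPoints p γ) :
    ∃ (k : Fin 2 → ℕ) (ζ : Fin 2 → ℂ_[p]), k 1 < k 0 ∧ (∀ i, IsPPowerRootOfUnity p (ζ i)) ∧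
      P = interpolationPoint p γ (k 0) (k 1) (ζ 0) (ζ 1) := by
  obtain ⟨k, s, hks, ζ, ζ', hζ, hζ', rfl⟩ := h
  refine ⟨![k, s], ![ζ, ζ'], hks, fun i => ?_, rfl⟩
  fin_cases i
  · exact hζ
  · exact hζ'

/-- A formal subtorus on whose translate by a point of a torsion stable set a power series vanishes
yields infinitely many zeros in the set. -/
theorem infinite_zeros_of_vanishesAlongTranslate (L : MvPowerSeries (Fin 2) ℤ_[p])
    {S : Set (Fin 2 → ℂ_[p])} (hS : S ⊆ interpolationPoints p γ) (hstable : IsTorsionStable p S)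
    {P : Fin 2 → ℂ_[p]} (hP : P ∈ S) {d : ℕ} (hd : 0 < d) (H : FormalSubtorus ℤ_[p] 2 d)
    (hH : VanishesAlongTranslate p L P H) : {P ∈ S | padicEval p L P = 0}.Infinite := by
  classical
  have hφ := norm_padicIntHom_le_one p
  have hP1 : ∀ i, 1 + P i ≠ 0 := by
    obtain ⟨k, ζ, -, hζ, rfl⟩ := exists_of_mem_interpolationPoints (hS hP)
    intro i
    rw [interpolationPoint_apply, add_sub_cancel]
    refine mul_ne_zero (pow_ne_zero _ ?_) (norm_ne_zero_iff.mp ?_)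
    · exact (map_ne_zero_iff _ (padicIntHom_injective p)).mpr γ.ne_zero
    · rw [(hζ i).norm_eq_one]
      exact one_ne_zero
  let w : ℂ_[p] → Fin d → ℂ_[p] := fun η => Function.update 1 ⟨0, hd⟩ η
  have hw1 : ∀ η : ℂ_[p], IsPPowerRootOfUnity p η → ∀ j, ‖(w η - 1) j‖ < 1 := by
    intro η hη j
    by_cases hj : j = ⟨0, hd⟩
    · subst hj; simpa [w] using hη.norm_sub_one_lt
    · simp [w, hj]
  let Q : ℂ_[p] → Fin 2 → ℂ_[p] := fun η i =>
    P i + padicEval p (H.toSeries i) (w η - 1) + P i * padicEval p (H.toSeries i) (w η - 1)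
  have hQ : ∀ η i, Q η i = (1 + P i) * H.onUnits i (w η) - 1 := fun η i => by
    simp only [Q, padicEval_eq_evalPowerSeries, FormalTorusHom.onUnits]
    ring
  have htors : ∀ η, IsPPowerRootOfUnity p η → ∀ i, IsPPowerRootOfUnity p (H.onUnits i (w η)) := by
    rintro η ⟨N, hN⟩ i
    refine H.isPPowerRootOfUnity_onUnits i (N := N) (funext fun j => ?_)
    by_cases hj : j = ⟨0, hd⟩
    · subst hj; simpa [w] using hN
    · simp [w, hj]
  refine Set.infinite_of_injOn_mapsTo (f := Q) ?_ ?_ infinite_setOf_isPPowerRootOfUnity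
  · intro η hη η' hη' h
    -- The closed immersion yields a series `f` that recovers the first parameter from the image
    -- point, so different torsion parameters give different zeros.
    obtain ⟨f, hf⟩ := H.surjective (X ⟨0, hd⟩)
    have hval : ∀ η, IsPPowerRootOfUnity p η → η - 1 = evalPowerSeries (padicIntHom p) f
        (fun i => H.onUnits i (w η) - 1) := fun η hη => by
      have h1 := evalPowerSeries_subst hφ (hw1 η hη) H.constantCoeff_eq_zero f
      dsimp only at hf
      rw [hf, evalPowerSeries_X hφ (hw1 η hη)] at h1
      simpa [w, FormalTorusHom.onUnits] using h1
    have hu : ∀ i, H.onUnits i (w η) = H.onUnits i (w η') := fun i => by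
      have h1 := congrFun h i
      rw [hQ, hQ, sub_left_inj] at h1
      exact mul_left_cancel₀ (hP1 i) h1
    have h1 := hval η hη
    simp only [hu] at h1
    rw [← hval η' hη'] at h1
    exact sub_left_inj.mp h1
  · intro η hη
    refine ⟨?_, hH _ (hw1 η hη)⟩
    have h1 := hstable P hP _ _ (htors η hη 0) (htors η hη 1)
    convert h1 using 1
    ext1 i
    rw [hQ]
    fin_cases i <;> rfl

/-- A power series with infinitely many zeros in the set vanishes along a translate of a line. -/
theorem exists_vanishesAlongTranslate_of_infinite (hγ : IsTopologicalGenerator p γ)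
    (L : MvPowerSeries (Fin 2) ℤ_[p]) (S : Set (Fin 2 → ℂ_[p]))
    (hS : S ⊆ interpolationPoints p γ) (χ : FormalCharacter ℤ_[p] 2) (hχ : χ.toSeries 0 ≠ 0)
    (hfin : ((fun e : ℕ × ℕ =>
      padicEval p (χ.toSeries 0) (interpolationPoint p γ e.1 e.2 1 1)) ''
        occurringExponents p γ S).Finite) (hinf : {P ∈ S | padicEval p L P = 0}.Infinite) :
    ∃ P ∈ S, ∃ d : ℕ, 0 < d ∧ ∃ H : FormalSubtorus ℤ_[p] 2 d, VanishesAlongTranslate p L P H := by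
  classical
  have hu := hγ.dvd_sub_one
  obtain ⟨α, hα, hαval⟩ := exists_linear_form χ hγ hχ
  have : Infinite {P ∈ S | padicEval p L P = 0} := hinf.to_subtype
  let ι := {P ∈ S | padicEval p L P = 0}
  have : Infinite ι := this
  let U : Ultrafilter ι := hyperfilter ι
  choose k ζ hks hζ hP using fun n : ι => exists_of_mem_interpolationPoints (hS n.2.1)
  have hzero : ∀ n, evalPowerSeries (padicIntHom p) L
      (fun i => padicIntHom p γ ^ k n i * ζ n i - 1) = 0 := fun n => by
    rw [← interpolationPoint_apply, ← hP n]
    exact n.2.2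
  have hconcl : ∀ (n : ι) (v : Fin 2 → ℤ_[p]) (i₀ : Fin 2), v i₀ = 1 →
      (∀ w : ℂ_[p], ‖w - 1‖ < 1 → evalPowerSeries (padicIntHom p) L
        (fun i => padicIntHom p γ ^ k n i * ζ n i * oneUnitPow w (v i) - 1) = 0) →
      ∃ P ∈ S, ∃ d : ℕ, 0 < d ∧ ∃ H : FormalSubtorus ℤ_[p] 2 d,
        VanishesAlongTranslate p L P H := by
    intro n v i₀ hv h
    refine ⟨n, n.2.1, 1, one_pos, lineSubtorus v i₀ hv,
      vanishesAlongTranslate_lineSubtorus hv L n fun w hw => ?_⟩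
    rw [hP n, interpolationPoint_apply]
    simpa using h w hw
  have hpow : ∀ᶠ n in (U : Filter ι),
      (∃ c : ℕ, ζ n 1 = ζ n 0 ^ c) ∨ ∃ c : ℕ, ζ n 0 = ζ n 1 ^ c :=
    Eventually.of_forall fun n => exists_eq_pow_or_eq_pow (hζ n 0) (hζ n 1)
  obtain ⟨i₀, i₁, hi, hpow⟩ : ∃ i₀ i₁ : Fin 2, i₀ ≠ i₁ ∧
      ∀ᶠ n in (U : Filter ι), ∃ c : ℕ, ζ n i₁ = ζ n i₀ ^ c := by
    rcases Ultrafilter.eventually_or.mp hpow with h | h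
    · exact ⟨0, 1, by decide, h⟩
    · exact ⟨1, 0, by decide, h⟩
  by_cases hord : ∀ N : ℕ, ∀ᶠ n in (U : Filter ι), ζ n i₀ ^ p ^ N ≠ 1
  · obtain ⟨v, hv, n, h⟩ :=
      exists_eval_eq_zero_of_unbounded_order hu U L ζ hζ k hi hpow hord hzero
    exact hconcl n v i₀ hv h
  push Not at hord
  obtain ⟨N, hN⟩ := hord
  obtain ⟨ξ₀, -, hξ₀⟩ := U.exists_eventually_eq (finite_setOf_pow_eq_one (p := p) N) hN
  obtain ⟨ξ₁, -, hξ₁⟩ := U.exists_eventually_eq (finite_setOf_pow_eq_one (p := p) N)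
    (f := fun n => ζ n i₁) (by
      filter_upwards [hN, hpow] with n h1 ⟨c, h2⟩
      change ζ n i₁ ^ p ^ N = 1
      rw [h2, ← pow_mul, mul_comm, pow_mul, h1, one_pow])
  have hmem : ∀ n, oneUnitPow (padicIntHom p γ) (α 0 * k n 0 + α 1 * k n 1) - 1 ∈
      ((fun e : ℕ × ℕ => padicEval p (χ.toSeries 0) (interpolationPoint p γ e.1 e.2 1 1)) ''
        occurringExponents p γ S) := fun n =>
    ⟨(k n 0, k n 1), ⟨hks n, ζ n 0, ζ n 1, hζ n 0, hζ n 1, hP n ▸ n.2.1⟩, hαval _ _⟩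
  -- Finitely many character values mean one constant value along `U`; injectivity of `a ↦ γ ^ a`
  -- then fixes the linear form in the exponents.
  obtain ⟨b, -, hb⟩ := U.exists_eventually_eq hfin (Eventually.of_forall hmem)
  have hgood := hb.and (hξ₀.and hξ₁)
  obtain ⟨n₀, hn1, hn2, hn3⟩ := hgood.exists
  have hsame : ∀ᶠ n in (U : Filter ι),
      (∀ i, ζ n i = ζ n₀ i) ∧ ∑ i, α i * ((k n i : ℤ_[p]) - k n₀ i) = 0 := by
    filter_upwards [hgood] with n ⟨h1, h2, h3⟩
    refine ⟨fun i => ?_, ?_⟩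
    · rcases fin_two_cases hi i with rfl | rfl
      · rw [h2, hn2]
      · rw [h3, hn3]
    · have h4 := oneUnitPow_padicIntHom_injective hu hγ.ne_one
        (sub_left_inj.mp (h1.trans hn1.symm))
      rw [Fin.sum_univ_two]
      linear_combination h4
  -- In the valuation ring `ℤ_p` one coefficient divides the other. Dividing by it solves for one
  -- exponent with an integral slope, so the line has an exponent equal to one.
  obtain ⟨j₀, j₁, hj, hα1, β, hβ⟩ : ∃ j₀ j₁ : Fin 2, j₀ ≠ j₁ ∧ α j₁ ≠ 0 ∧
      ∃ β : ℤ_[p], α j₀ = α j₁ * β := by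
    have h0 : ∀ {i j : Fin 2}, i ≠ j → α j ∣ α i → α j ≠ 0 := fun {i j} hij h hj0 => by
      rw [hj0, zero_dvd_iff] at h
      refine hα (funext fun l => ?_)
      rcases fin_two_cases hij l with rfl | rfl
      · exact h
      · exact hj0
    rcases ValuationRing.dvd_total (α 0) (α 1) with h | h
    · exact ⟨1, 0, by decide, h0 (by decide) h, h⟩
    · exact ⟨0, 1, by decide, h0 (by decide) h, h⟩
  let v : Fin 2 → ℤ_[p] := fun i => if i = j₀ then 1 else -β
  have hv0 : v j₀ = 1 := if_pos rfl
  have hv1 : v j₁ = -β := if_neg hj.symm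
  have hrel : ∀ᶠ n in (U : Filter ι), ∀ i,
      (k n i : ℤ_[p]) - k n₀ i = v i * ((k n j₀ : ℤ_[p]) - k n₀ j₀) := by
    filter_upwards [hsame] with n ⟨_, h⟩ i
    have h1 : α j₀ * ((k n j₀ : ℤ_[p]) - k n₀ j₀) + α j₁ * ((k n j₁ : ℤ_[p]) - k n₀ j₁) = 0 := by
      rw [← h, ← Finset.sum_pair (f := fun i => α i * ((k n i : ℤ_[p]) - k n₀ i)) hj]
      congr 1
      ext l
      rcases fin_two_cases hj l with rfl | rfl <;> simp
    rcases fin_two_cases hj i with rfl | rfl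
    · rw [hv0, one_mul]
    · rw [hv1]
      refine mul_left_cancel₀ hα1 ?_
      rw [hβ] at h1
      linear_combination h1
  have hkinf : ∀ m : ℕ, ∀ᶠ n in (U : Filter ι), k n j₀ ≠ m := by
    intro m
    by_contra hm
    rw [← Ultrafilter.eventually_not] at hm
    simp only [not_not] at hm
    -- A constant exponent `k n j₀` would determine the other exponent and hence the zero itself,
    -- contradicting non-principality of `U`.
    obtain ⟨n₁, h1, h2, h3⟩ := (hm.and (hrel.and hsame)).exists
    have hconst : ∀ᶠ n in (U : Filter ι), n = n₁ := by
      filter_upwards [hm, hrel, hsame] with n h4 h5 h6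
      refine Subtype.ext ?_
      rw [hP n, hP n₁, interpolationPoint_apply, interpolationPoint_apply]
      have hk : ∀ i, k n i = k n₁ i := fun i => by
        have h7 := h5 i
        rw [h4, ← h1, ← h2 i, sub_left_inj] at h7
        exact_mod_cast h7
      simp only [hk, h6.1, h3.1]
    have hfin1 : {n : ι | n = n₁}.Finite := Set.finite_singleton n₁
    exact notMem_hyperfilter_of_finite hfin1 hconst
  refine hconcl n₀ v j₀ hv0 fun w hw => ?_
  refine eval_eq_zero_of_zeros_on_line hu U hγ.ne_one L (ζ n₀) (hζ n₀) k (k n₀) j₀ v hrel hkinf ?_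
    w hw
  filter_upwards [hsame] with n ⟨h1, _⟩
  have h2 := hzero n
  simp only [h1] at h2
  exact h2

end MainTheorem

theorem mainTheorem3 (p : ℕ) [Fact p.Prime] (γ : ℤ_[p]ˣ) (hγ : IsTopologicalGenerator p γ)
    (L : MvPowerSeries (Fin 2) ℤ_[p])
    (S : Set (Fin 2 → ℂ_[p])) (hS : S ⊆ interpolationPoints p γ)
    (χ : FormalCharacter ℤ_[p] 2) (hχ : χ.toSeries 0 ≠ 0)
    (hfin : ((fun e : ℕ × ℕ =>
      padicEval p (χ.toSeries 0) (interpolationPoint p γ e.1 e.2 1 1)) ''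
        occurringExponents p γ S).Finite) :
    ({P ∈ S | padicEval p L P = 0}.Finite ∨
      ∃ P ∈ S, ∃ d : ℕ, 0 < d ∧ ∃ H : FormalSubtorus ℤ_[p] 2 d, VanishesAlongTranslate p L P H) ∧
    (IsTorsionStable p S →
      ¬ ({P ∈ S | padicEval p L P = 0}.Finite ∧
        ∃ P ∈ S, ∃ d : ℕ, 0 < d ∧
          ∃ H : FormalSubtorus ℤ_[p] 2 d, VanishesAlongTranslate p L P H)) := by
  refine ⟨?_, ?_⟩
  · by_cases h : {P ∈ S | padicEval p L P = 0}.Finite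
    · exact Or.inl h
    · exact Or.inr (exists_vanishesAlongTranslate_of_infinite hγ L S hS χ hχ hfin h)
  · rintro hstable ⟨hfinite, P, hP, d, hd, H, hH⟩
    exact infinite_zeros_of_vanishesAlongTranslate L hS hstable hP hd H hH hfinite
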